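/- Let $M\subset\mathbb R^{d+1}$ be a $d$-dimensional embedded differentiable surface: every point of $M$ lies in a relatively open subset of $M$ which is the homeomorphic image $m(\Omega)$ of an open set $\Omega\subset\mathbb R^d$ under a $C^1$ immersion $m:\Omega\to\mathbb R^{d+1}$ (a local parametrization). Write $s$ for the $d$-dimensional surface measure on $M$, $\mathcal T_xM$ and $\mathcal N_xM=(\mathcal T_xM)^\perp$ for the tangent and normal spaces, and let $n$ be a unit normal vector field on $M$ of class $C^1$ (in particular $M$ is oriented; every oriented $C^2$ or smooth surface is of this kind). Put $P_n(x)=n(x)n(x)^T$ and $P_\tau(x)=I-P_n(x)$. For $u:M\to\mathbb R^{d+1}$ the surface gradient is defined in local parametrizations by $$\nabla_M u(m(\zeta))=\partial(u\circ m)(\zeta)\,(\partial m(\zeta))^\dagger\in\mathbb R^{(d+1)\times(d+1)},\qquad (\partial m)^\dagger=\big((\partial m)^T\partial m\big)^{-1}(\partial m)^T,$$ where $\partial(u\circ m)\in L^1_{loc}(\Omega)$ is the weak derivative of $u\circ m\in L^1_{loc}(\Omega)$. Assume that $M$ has bounded curvature: there is a constant $C_c$ with $|\nabla_M n(x)|\le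 C_c$ for all $x\in M$ ($|\cdot|$ the Frobenius norm). Identify fields that are equal $s$-almost everywhere, let $L^2(M)$ be the square integrable (vector or matrix valued) fields on $M$ with $\langle U_1,U_2\rangle_{L^2(M)}=\int_M U_1\cdot U_2\,ds$ (componentwise product), and define - $H^1_\tau(M)$: the fields $u\in L^2(M)$ with $u(x)\in\mathcal T_xM$ for all $x\in M$ that have a surface gradient $\nabla_M u$ with $U=P_\tau\nabla_M u\in L^2(M)$; - $H^1_n(M)$: the fields $u\in L^2(M)$ with $u(x)\in\mathcal N_xM$ for all $x\in M$ that have a surface gradient $\nabla_M u$ with $U=P_n\nabla_M u\in L^2(M)$; - $H^1(M)$: the sums $u=\tilde u+w$ with $\tilde u\in H^1_\tau(M)$, $w\in H^1_n(M)$, for which $U=P_\tau\nabla_M(P_\tau u)+P_n\nabla_M(P_n u)\in L^2(M)$. On each of these three spaces put $$\langle u_1,u_2\rangle=\int_M u_1\cdot u_2\,ds+\int_M U_1\cdot U_2\,ds,$$ where $U_i$ is the field $U$ that belongs to $u_i$ in the definition of that space. Then $H^1(M)$, $H^1_\tau(M)$ and $H^1_n(M)$, each with its own inner product, are real Hilbert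 spaces: the form above is a well-defined inner product on the (real) vector space in question, and the space is complete for the norm that it induces. -/

import Mathlib

open MeasureTheory
open scoped InnerProductSpace

noncomputable section

/-- Euclidean space `ℝᵏ`. -/
abbrev Euc (k : ℕ) : Type := EuclideanSpace ℝ (Fin k)

/-! ### Hypersurfaces in `ℝᵈ⁺¹` -/

/-- `m : Ω → M` is a regular local parametrization of `M ⊆ ℝᵈ⁺¹`: `Ω ⊆ ℝᵈ` is open, `m` is a `C¹`
immersion on `Ω`, and it is a homeomorphism of `Ω` onto a relatively open subset of `M`. -/
structure IsPatch {d : ℕ} (M : Set (Euc (d + 1))) (Ω : Set (Euc d)) (m : Euc d → Euc (d + 1)) :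
    Prop where
  isOpen : IsOpen Ω
  contDiffOn : ContDiffOn ℝ 1 m Ω
  injective_fderiv : ∀ ζ ∈ Ω, Function.Injective (fderiv ℝ m ζ)
  isEmbedding : Topology.IsEmbedding (Ω.domRestrict m)
  relOpen : ∃ U : Set (Euc (d + 1)), IsOpen U ∧ m '' Ω = M ∩ U

/-- `M` is a `d`-dimensional (embedded, differentiable) surface in `ℝᵈ⁺¹`. -/
def IsHypersurface {d : ℕ} (M : Set (Euc (d + 1))) : Prop :=
  ∀ x ∈ M, ∃ (Ω : Set (Euc d)) (m : Euc d → Euc (d + 1)), IsPatch M Ω m ∧ x ∈ m '' Ω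

/-- The `d`-dimensional surface measure of `M` (the Hausdorff measure, normalized such that it is
Lebesgue measure on `d`-dimensional planes). -/
def surfaceMeasure {d : ℕ} (M : Set (Euc (d + 1))) : Measure (Euc (d + 1)) :=
  (Measure.euclideanHausdorffMeasure d).restrict M

/-- The tangent space of `M` at `x`: it is spanned by the tangent vectors `∂m(ζ) h`, where `m` is a
local parametrization of `M` and `m(ζ) = x`. -/
def tangentSpaceAt {d : ℕ} (M : Set (Euc (d + 1))) (x : Euc (d + 1)) :
    Submodule ℝ (Euc (d + 1)) :=
  Submodule.span ℝ {v | ∃ (Ω : Set (Euc d)) (m : Euc d → Euc (d + 1)) (ζ h : Euc d),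
    IsPatch M Ω m ∧ ζ ∈ Ω ∧ m ζ = x ∧ v = fderiv ℝ m ζ h}

/-- The normal space of `M` at `x`. -/
def normalSpaceAt {d : ℕ} (M : Set (Euc (d + 1))) (x : Euc (d + 1)) :
    Submodule ℝ (Euc (d + 1)) :=
  (tangentSpaceAt M x)ᗮ

/-- The Moore-Penrose inverse `L† = (Lᵀ L)⁻¹ Lᵀ` of an injective linear map `L : ℝᵈ → ℝᵈ⁺¹`. -/
def pinv {d : ℕ} (L : Euc d →L[ℝ] Euc (d + 1)) : Euc (d + 1) →L[ℝ] Euc d :=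
  (ContinuousLinearMap.inverse (ContinuousLinearMap.adjoint L ∘L L)) ∘L
    ContinuousLinearMap.adjoint L

/-- The Frobenius inner product `∑ᵢⱼ Aᵢⱼ Bᵢⱼ`, summed column by column. -/
def frobInner {k : ℕ} (A B : Euc k →L[ℝ] Euc k) : ℝ :=
  ∑ j : Fin k, ⟪A (EuclideanSpace.single j 1), B (EuclideanSpace.single j 1)⟫_ℝ

/-- `n` is a unit normal field on `M` (an orientation of `M`), of class `C¹`. -/
structure IsUnitNormal {d : ℕ} (M : Set (Euc (d + 1))) (n : Euc (d + 1) → Euc (d + 1)) :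
    Prop where
  norm_eq_one : ∀ x ∈ M, ‖n x‖ = 1
  mem_normalSpace : ∀ x ∈ M, n x ∈ normalSpaceAt M x
  contDiffOn : ∀ (Ω : Set (Euc d)) (m : Euc d → Euc (d + 1)), IsPatch M Ω m →
    ContDiffOn ℝ 1 (n ∘ m) Ω

/-- `sup_{x ∈ M} |∇_M n(x)| ≤ C`, where `∇_M n(m(ζ)) = ∂(n ∘ m)(ζ) (∂m(ζ))†` is the surface gradient
and `|·|` is the Frobenius norm. -/
def CurvatureBound {d : ℕ} (M : Set (Euc (d + 1))) (n : Euc (d + 1) → Euc (d + 1)) (C : ℝ) :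
    Prop :=
  ∀ (Ω : Set (Euc d)) (m : Euc d → Euc (d + 1)), IsPatch M Ω m → ∀ ζ ∈ Ω,
    √(frobInner (fderiv ℝ (n ∘ m) ζ ∘L pinv (fderiv ℝ m ζ))
      (fderiv ℝ (n ∘ m) ζ ∘L pinv (fderiv ℝ m ζ))) ≤ C

/-- The normal projection `P_n(x) = n(x) n(x)ᵀ`. -/
def projN {d : ℕ} (n : Euc (d + 1) → Euc (d + 1)) (x : Euc (d + 1)) :
    Euc (d + 1) →L[ℝ] Euc (d + 1) :=
  (innerSL ℝ (n x)).smulRight (n x)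

/-- The tangential projection `P_τ(x) = I - n(x) n(x)ᵀ`. -/
def projT {d : ℕ} (n : Euc (d + 1) → Euc (d + 1)) (x : Euc (d + 1)) :
    Euc (d + 1) →L[ℝ] Euc (d + 1) :=
  ContinuousLinearMap.id ℝ (Euc (d + 1)) - projN n x

/-! ### Weak derivatives -/

/-- `D ∈ L¹_loc(Ω)` is the weak Jacobian of `u ∈ L¹_loc(Ω)` on the open set `Ω ⊆ ℝᵈ`:
`∫ (∂ᵥφ) u = - ∫ φ (D v)` for all vectors `v` and all test functions `φ ∈ C¹_c(Ω)`.
(Testing with `C¹_c(Ω)` and with `C^∞_c(Ω)` is equivalent, by mollification.) -/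
structure IsWeakJacobian {d k : ℕ} (Ω : Set (Euc d)) (u : Euc d → Euc k)
    (D : Euc d → (Euc d →L[ℝ] Euc k)) : Prop where
  locallyIntegrableOn : LocallyIntegrableOn u Ω
  locallyIntegrableOn_deriv : LocallyIntegrableOn D Ω
  integral_eq : ∀ φ : Euc d → ℝ, ContDiff ℝ 1 φ → HasCompactSupport φ → tsupport φ ⊆ Ω →
    ∀ v : Euc d, ∫ ζ in Ω, (fderiv ℝ φ ζ v) • u ζ = - ∫ ζ in Ω, φ ζ • D ζ v

/-- `G` is the (weak) surface gradient of `u : M → ℝᵈ⁺¹`: in every local parametrization `m`,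
`G(m(ζ)) = ∂(u ∘ m)(ζ) (∂m(ζ))†` for a.e. `ζ`, where `∂` is the weak derivative. -/
def IsSurfaceGradient {d : ℕ} (M : Set (Euc (d + 1))) (u : Euc (d + 1) → Euc (d + 1))
    (G : Euc (d + 1) → (Euc (d + 1) →L[ℝ] Euc (d + 1))) : Prop :=
  ∀ (Ω : Set (Euc d)) (m : Euc d → Euc (d + 1)), IsPatch M Ω m →
    ∃ D : Euc d → (Euc d →L[ℝ] Euc (d + 1)), IsWeakJacobian Ω (u ∘ m) D ∧
      ∀ᵐ ζ ∂(volume.restrict Ω), G (m ζ) = D ζ ∘L pinv (fderiv ℝ m ζ)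

lemma integrable_testFunction_smul {d : ℕ} {F : Type*} [NormedAddCommGroup F]
    [NormedSpace ℝ F] {Ω : Set (Euc d)} {u : Euc d → F} (hu : LocallyIntegrableOn u Ω)
    {φ : Euc d → ℝ} (hφ : Continuous φ) (hc : HasCompactSupport φ) (hs : tsupport φ ⊆ Ω) :
    Integrable (fun ζ => φ ζ • u ζ) (volume.restrict Ω) := by
  have h1 : IntegrableOn (fun ζ => φ ζ • u ζ) (tsupport φ) :=
    (hu.integrableOn_compact_subset hs hc).continuousOn_smul hφ.continuousOn hc
  refine IntegrableOn.mono_set ((integrableOn_iff_integrable_of_support_subset ?_).1 h1).integrableOn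
    (Set.subset_univ _)
  intro ζ hζ
  refine subset_tsupport φ ?_
  intro h0
  apply hζ
  simp [h0]

lemma integrable_testFunction {d k : ℕ} {Ω : Set (Euc d)} {u : Euc d → Euc k}
    {D : Euc d → (Euc d →L[ℝ] Euc k)} (h : IsWeakJacobian Ω u D)
    {φ : Euc d → ℝ} (hφ : ContDiff ℝ 1 φ) (hc : HasCompactSupport φ) (hs : tsupport φ ⊆ Ω)
    (v : Euc d) :
    Integrable (fun ζ => (fderiv ℝ φ ζ v) • u ζ) (volume.restrict Ω) ∧
      Integrable (fun ζ => φ ζ • D ζ v) (volume.restrict Ω) := by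
  constructor
  · have hsub : tsupport (fun ζ => fderiv ℝ φ ζ v) ⊆ tsupport φ :=
      (tsupport_comp_subset (g := fun L : Euc d →L[ℝ] ℝ => L v) rfl _).trans
        (tsupport_fderiv_subset ℝ)
    exact integrable_testFunction_smul h.locallyIntegrableOn
      ((hφ.continuous_fderiv one_ne_zero).clm_apply continuous_const)
      (hc.of_isClosed_subset (isClosed_tsupport _) hsub) (hsub.trans hs)
  · exact (integrable_testFunction_smul h.locallyIntegrableOn_deriv hφ.continuous hc
      hs).apply_continuousLinearMap v

lemma IsWeakJacobian.zero {d k : ℕ} (Ω : Set (Euc d)) :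
    IsWeakJacobian Ω (fun _ => (0 : Euc k)) (fun _ => 0) where
  locallyIntegrableOn :=
    (integrable_zero (Euc d) (Euc k) volume).locallyIntegrable.locallyIntegrableOn Ω
  locallyIntegrableOn_deriv :=
    (integrable_zero (Euc d) (Euc d →L[ℝ] Euc k) volume).locallyIntegrable.locallyIntegrableOn Ω
  integral_eq := by simp

lemma IsWeakJacobian.add {d k : ℕ} {Ω : Set (Euc d)} {u v : Euc d → Euc k}
    {D E : Euc d → (Euc d →L[ℝ] Euc k)} (hu : IsWeakJacobian Ω u D) (hv : IsWeakJacobian Ω v E) :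
    IsWeakJacobian Ω (fun ζ => u ζ + v ζ) (fun ζ => D ζ + E ζ) where
  locallyIntegrableOn := hu.locallyIntegrableOn.add hv.locallyIntegrableOn
  locallyIntegrableOn_deriv :=
    LocallyIntegrableOn.add (f := D) (g := E) hu.locallyIntegrableOn_deriv
      hv.locallyIntegrableOn_deriv
  integral_eq := by
    intro φ hφ hc hs w
    obtain ⟨a1, a2⟩ := integrable_testFunction hu hφ hc hs w
    obtain ⟨b1, b2⟩ := integrable_testFunction hv hφ hc hs w
    simp only [smul_add, add_apply]
    rw [integral_add a1 b1, integral_add a2 b2, hu.integral_eq φ hφ hc hs w,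
      hv.integral_eq φ hφ hc hs w, neg_add]

lemma IsWeakJacobian.const_smul {d k : ℕ} {Ω : Set (Euc d)} {u : Euc d → Euc k}
    {D : Euc d → (Euc d →L[ℝ] Euc k)} (hu : IsWeakJacobian Ω u D) (c : ℝ) :
    IsWeakJacobian Ω (fun ζ => c • u ζ) (fun ζ => c • D ζ) where
  locallyIntegrableOn := hu.locallyIntegrableOn.smul c
  locallyIntegrableOn_deriv := hu.locallyIntegrableOn_deriv.smul c
  integral_eq := by
    intro φ hφ hc hs w
    simp only [smul_apply, smul_comm _ c, integral_smul]
    rw [hu.integral_eq φ hφ hc hs w, smul_neg]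

lemma IsSurfaceGradient.zero {d : ℕ} (M : Set (Euc (d + 1))) :
    IsSurfaceGradient M (fun _ => 0) (fun _ => 0) := fun Ω _ _ =>
  ⟨fun _ => 0, IsWeakJacobian.zero Ω, by simp⟩

lemma IsSurfaceGradient.add {d : ℕ} {M : Set (Euc (d + 1))} {u v : Euc (d + 1) → Euc (d + 1)}
    {G H : Euc (d + 1) → (Euc (d + 1) →L[ℝ] Euc (d + 1))} (hu : IsSurfaceGradient M u G)
    (hv : IsSurfaceGradient M v H) :
    IsSurfaceGradient M (fun x => u x + v x) (fun x => G x + H x) := by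
  intro Ω m hm
  obtain ⟨D, hD, hDG⟩ := hu Ω m hm
  obtain ⟨E, hE, hEH⟩ := hv Ω m hm
  refine ⟨_, hD.add hE, ?_⟩
  filter_upwards [hDG, hEH] with ζ h1 h2
  rw [h1, h2, ContinuousLinearMap.add_comp]

lemma IsSurfaceGradient.const_smul {d : ℕ} {M : Set (Euc (d + 1))}
    {u : Euc (d + 1) → Euc (d + 1)} {G : Euc (d + 1) → (Euc (d + 1) →L[ℝ] Euc (d + 1))}
    (hu : IsSurfaceGradient M u G) (c : ℝ) :
    IsSurfaceGradient M (fun x => c • u x) (fun x => c • G x) := by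
  intro Ω m hm
  obtain ⟨D, hD, hDG⟩ := hu Ω m hm
  refine ⟨_, hD.const_smul c, ?_⟩
  filter_upwards [hDG] with ζ h1
  rw [h1, ContinuousLinearMap.smul_comp]

/-! ### The spaces -/

/-- `L²(M, ℝᵈ⁺¹)`, as equivalence classes of fields modulo equality almost everywhere. -/
abbrev L2Fields {d : ℕ} (M : Set (Euc (d + 1))) : Type := Lp (Euc (d + 1)) 2 (surfaceMeasure M)

/-- `U = P_τ ∇_M u`, where `u` is (the class of) a tangential field. -/
def IsTangentialGradient {d : ℕ} (M : Set (Euc (d + 1))) (n : Euc (d + 1) → Euc (d + 1))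
    (u : L2Fields M) (U : Euc (d + 1) → (Euc (d + 1) →L[ℝ] Euc (d + 1))) : Prop :=
  ∃ (f : Euc (d + 1) → Euc (d + 1)) (G : Euc (d + 1) → (Euc (d + 1) →L[ℝ] Euc (d + 1))),
    u =ᵐ[surfaceMeasure M] f ∧ (∀ x ∈ M, f x ∈ tangentSpaceAt M x) ∧ IsSurfaceGradient M f G ∧
      U = fun x => projT n x ∘L G x

/-- `U = P_n ∇_M u`, where `u` is (the class of) a normal field. -/
def IsNormalGradient {d : ℕ} (M : Set (Euc (d + 1))) (n : Euc (d + 1) → Euc (d + 1))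
    (u : L2Fields M) (U : Euc (d + 1) → (Euc (d + 1) →L[ℝ] Euc (d + 1))) : Prop :=
  ∃ (f : Euc (d + 1) → Euc (d + 1)) (G : Euc (d + 1) → (Euc (d + 1) →L[ℝ] Euc (d + 1))),
    u =ᵐ[surfaceMeasure M] f ∧ (∀ x ∈ M, f x ∈ normalSpaceAt M x) ∧ IsSurfaceGradient M f G ∧
      U = fun x => projN n x ∘L G x

/-- `U = P_τ ∇_M (P_τ u) + P_n ∇_M (P_n u)`. -/
def IsProjectedGradient {d : ℕ} (M : Set (Euc (d + 1))) (n : Euc (d + 1) → Euc (d + 1))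
    (u : L2Fields M) (U : Euc (d + 1) → (Euc (d + 1) →L[ℝ] Euc (d + 1))) : Prop :=
  ∃ (f : Euc (d + 1) → Euc (d + 1)) (G H : Euc (d + 1) → (Euc (d + 1) →L[ℝ] Euc (d + 1))),
    u =ᵐ[surfaceMeasure M] f ∧ IsSurfaceGradient M (fun x => projT n x (f x)) G ∧
      IsSurfaceGradient M (fun x => projN n x (f x)) H ∧
      U = fun x => projT n x ∘L G x + projN n x ∘L H x

lemma IsTangentialGradient.zero {d : ℕ} (M : Set (Euc (d + 1))) (n : Euc (d + 1) → Euc (d + 1)) :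
    IsTangentialGradient M n 0 (fun _ => 0) :=
  ⟨fun _ => 0, fun _ => 0, Lp.coeFn_zero _ _ _, fun _ _ => zero_mem _, IsSurfaceGradient.zero M,
    by simp⟩

lemma IsTangentialGradient.add {d : ℕ} {M : Set (Euc (d + 1))} {n : Euc (d + 1) → Euc (d + 1)}
    {u v : L2Fields M} {U V : Euc (d + 1) → (Euc (d + 1) →L[ℝ] Euc (d + 1))}
    (hu : IsTangentialGradient M n u U) (hv : IsTangentialGradient M n v V) :
    IsTangentialGradient M n (u + v) (fun x => U x + V x) := by
  obtain ⟨f, G, h1, h2, h3, rfl⟩ := hu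
  obtain ⟨g, H, k1, k2, k3, rfl⟩ := hv
  exact ⟨_, _, (Lp.coeFn_add u v).trans (h1.add k1), fun x hx => add_mem (h2 x hx) (k2 x hx),
    h3.add k3, by simp⟩

lemma IsTangentialGradient.const_smul {d : ℕ} {M : Set (Euc (d + 1))}
    {n : Euc (d + 1) → Euc (d + 1)} {u : L2Fields M}
    {U : Euc (d + 1) → (Euc (d + 1) →L[ℝ] Euc (d + 1))} (hu : IsTangentialGradient M n u U)
    (c : ℝ) : IsTangentialGradient M n (c • u) (fun x => c • U x) := by
  obtain ⟨f, G, h1, h2, h3, rfl⟩ := hu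
  exact ⟨_, _, (Lp.coeFn_smul c u).trans (h1.const_smul c),
    fun x hx => Submodule.smul_mem _ c (h2 x hx), h3.const_smul c, by simp⟩

lemma IsNormalGradient.zero {d : ℕ} (M : Set (Euc (d + 1))) (n : Euc (d + 1) → Euc (d + 1)) :
    IsNormalGradient M n 0 (fun _ => 0) :=
  ⟨fun _ => 0, fun _ => 0, Lp.coeFn_zero _ _ _, fun _ _ => zero_mem _, IsSurfaceGradient.zero M,
    by simp⟩

lemma IsNormalGradient.add {d : ℕ} {M : Set (Euc (d + 1))} {n : Euc (d + 1) → Euc (d + 1)}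
    {u v : L2Fields M} {U V : Euc (d + 1) → (Euc (d + 1) →L[ℝ] Euc (d + 1))}
    (hu : IsNormalGradient M n u U) (hv : IsNormalGradient M n v V) :
    IsNormalGradient M n (u + v) (fun x => U x + V x) := by
  obtain ⟨f, G, h1, h2, h3, rfl⟩ := hu
  obtain ⟨g, H, k1, k2, k3, rfl⟩ := hv
  exact ⟨_, _, (Lp.coeFn_add u v).trans (h1.add k1), fun x hx => add_mem (h2 x hx) (k2 x hx),
    h3.add k3, by simp⟩

lemma IsNormalGradient.const_smul {d : ℕ} {M : Set (Euc (d + 1))}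
    {n : Euc (d + 1) → Euc (d + 1)} {u : L2Fields M}
    {U : Euc (d + 1) → (Euc (d + 1) →L[ℝ] Euc (d + 1))} (hu : IsNormalGradient M n u U)
    (c : ℝ) : IsNormalGradient M n (c • u) (fun x => c • U x) := by
  obtain ⟨f, G, h1, h2, h3, rfl⟩ := hu
  exact ⟨_, _, (Lp.coeFn_smul c u).trans (h1.const_smul c),
    fun x hx => Submodule.smul_mem _ c (h2 x hx), h3.const_smul c, by simp⟩

lemma IsProjectedGradient.zero {d : ℕ} (M : Set (Euc (d + 1))) (n : Euc (d + 1) → Euc (d + 1)) :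
    IsProjectedGradient M n 0 (fun _ => 0) :=
  ⟨fun _ => 0, fun _ => 0, fun _ => 0, Lp.coeFn_zero _ _ _,
    by simpa using IsSurfaceGradient.zero M, by simpa using IsSurfaceGradient.zero M, by simp⟩

lemma IsProjectedGradient.add {d : ℕ} {M : Set (Euc (d + 1))} {n : Euc (d + 1) → Euc (d + 1)}
    {u v : L2Fields M} {U V : Euc (d + 1) → (Euc (d + 1) →L[ℝ] Euc (d + 1))}
    (hu : IsProjectedGradient M n u U) (hv : IsProjectedGradient M n v V) :
    IsProjectedGradient M n (u + v) (fun x => U x + V x) := by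
  obtain ⟨f, G, H, h1, h2, h3, rfl⟩ := hu
  obtain ⟨g, G', H', k1, k2, k3, rfl⟩ := hv
  refine ⟨_, _, _, (Lp.coeFn_add u v).trans (h1.add k1), by simpa using h2.add k2,
    by simpa using h3.add k3, ?_⟩
  funext x
  simp only [ContinuousLinearMap.comp_add]
  abel

lemma IsProjectedGradient.const_smul {d : ℕ} {M : Set (Euc (d + 1))}
    {n : Euc (d + 1) → Euc (d + 1)} {u : L2Fields M}
    {U : Euc (d + 1) → (Euc (d + 1) →L[ℝ] Euc (d + 1))} (hu : IsProjectedGradient M n u U)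
    (c : ℝ) : IsProjectedGradient M n (c • u) (fun x => c • U x) := by
  obtain ⟨f, G, H, h1, h2, h3, rfl⟩ := hu
  exact ⟨_, _, _, (Lp.coeFn_smul c u).trans (h1.const_smul c), by simpa using h2.const_smul c,
    by simpa using h3.const_smul c, by simp⟩

lemma memLp_zero_field {d : ℕ} (M : Set (Euc (d + 1))) :
    MemLp (fun _ => 0 : Euc (d + 1) → (Euc (d + 1) →L[ℝ] Euc (d + 1))) 2 (surfaceMeasure M) :=
  MemLp.zero (ε := Euc (d + 1) →L[ℝ] Euc (d + 1))

lemma memLp_smul_field {d : ℕ} {M : Set (Euc (d + 1))}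
    {U : Euc (d + 1) → (Euc (d + 1) →L[ℝ] Euc (d + 1))} (h : MemLp U 2 (surfaceMeasure M))
    (c : ℝ) : MemLp (fun x => c • U x) 2 (surfaceMeasure M) :=
  MemLp.const_smul (f := U) h c

lemma memLp_add_field {d : ℕ} {M : Set (Euc (d + 1))}
    {U V : Euc (d + 1) → (Euc (d + 1) →L[ℝ] Euc (d + 1))} (h : MemLp U 2 (surfaceMeasure M))
    (k : MemLp V 2 (surfaceMeasure M)) : MemLp (fun x => U x + V x) 2 (surfaceMeasure M) :=
  MemLp.add (f := U) (g := V) h k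

/-- `H¹_τ(M)`: the tangential fields `u` with `u, P_τ ∇_M u ∈ L²(M)`.  (Square integrability of a
matrix field does not depend on the choice of the norm on matrices.) -/
def H1tau {d : ℕ} (M : Set (Euc (d + 1))) (n : Euc (d + 1) → Euc (d + 1)) :
    Submodule ℝ (L2Fields M) where
  carrier := {u | ∃ U, IsTangentialGradient M n u U ∧ MemLp U 2 (surfaceMeasure M)}
  zero_mem' := by
    rw [Set.mem_ofPred_eq]
    exact ⟨fun _ => 0, IsTangentialGradient.zero M n, memLp_zero_field M⟩
  add_mem' := by
    rintro u v ⟨U, h1, h2⟩ ⟨V, k1, k2⟩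
    exact ⟨_, h1.add k1, memLp_add_field h2 k2⟩
  smul_mem' := by
    rintro c u ⟨U, h1, h2⟩
    exact ⟨_, h1.const_smul c, memLp_smul_field h2 c⟩

/-- `H¹_n(M)`: the normal fields `u` with `u, P_n ∇_M u ∈ L²(M)`. -/
def H1nor {d : ℕ} (M : Set (Euc (d + 1))) (n : Euc (d + 1) → Euc (d + 1)) :
    Submodule ℝ (L2Fields M) where
  carrier := {u | ∃ U, IsNormalGradient M n u U ∧ MemLp U 2 (surfaceMeasure M)}
  zero_mem' := by
    rw [Set.mem_ofPred_eq]
    exact ⟨fun _ => 0, IsNormalGradient.zero M n, memLp_zero_field M⟩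
  add_mem' := by
    rintro u v ⟨U, h1, h2⟩ ⟨V, k1, k2⟩
    exact ⟨_, h1.add k1, memLp_add_field h2 k2⟩
  smul_mem' := by
    rintro c u ⟨U, h1, h2⟩
    exact ⟨_, h1.const_smul c, memLp_smul_field h2 c⟩

/-- `H¹(M)`: the sums `u = ũ + w` with `ũ ∈ H¹_τ(M)` and `w ∈ H¹_n(M)` for which `u` and
`P_τ ∇_M (P_τ u) + P_n ∇_M (P_n u)` are in `L²(M)`. -/
def H1amb {d : ℕ} (M : Set (Euc (d + 1))) (n : Euc (d + 1) → Euc (d + 1)) :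
    Submodule ℝ (L2Fields M) where
  carrier := {u | (∃ v ∈ H1tau M n, ∃ w ∈ H1nor M n, u = v + w) ∧
    ∃ U, IsProjectedGradient M n u U ∧ MemLp U 2 (surfaceMeasure M)}
  zero_mem' := by
    rw [Set.mem_ofPred_eq]
    exact ⟨⟨0, zero_mem _, 0, zero_mem _, (add_zero 0).symm⟩, fun _ => 0,
      IsProjectedGradient.zero M n, memLp_zero_field M⟩
  add_mem' := by
    rintro u v ⟨⟨a, ha, b, hb, rfl⟩, U, h1, h2⟩ ⟨⟨a', ha', b', hb', rfl⟩, V, k1, k2⟩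
    exact ⟨⟨_, add_mem ha ha', _, add_mem hb hb', by abel⟩, _, h1.add k1, memLp_add_field h2 k2⟩
  smul_mem' := by
    rintro c u ⟨⟨a, ha, b, hb, rfl⟩, U, h1, h2⟩
    exact ⟨⟨_, Submodule.smul_mem _ c ha, _, Submodule.smul_mem _ c hb, by simp⟩, _,
      h1.const_smul c, memLp_smul_field h2 c⟩

/-- `⟨u₁, u₂⟩ = ∫_M u₁ · u₂ ds + ∫_M U₁ · U₂ ds`, where `Uᵢ` is the gradient of `uᵢ` in the sense of
the relation `R` (one of the three above); `Uᵢ` is unique up to equality almost everywhere. -/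
def sobolevInner {d : ℕ} (M : Set (Euc (d + 1)))
    (R : L2Fields M → (Euc (d + 1) → (Euc (d + 1) →L[ℝ] Euc (d + 1))) → Prop)
    (u₁ u₂ : L2Fields M) : ℝ :=
  (∫ x, ⟪u₁ x, u₂ x⟫_ℝ ∂(surfaceMeasure M)) +
    ∫ x, frobInner (Classical.epsilon (R u₁) x) (Classical.epsilon (R u₂) x) ∂(surfaceMeasure M)

/-- The real vector space `W` with `B` is a Hilbert space: `B` is an inner product on `W`, and `W` is
complete for the norm that `B` induces. -/
def IsHilbertSpaceWith (W : Type) [AddCommGroup W] [Module ℝ W] (B : W → W → ℝ) : Prop :=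
  ∃ c : InnerProductSpace.Core ℝ W, (∀ u v : W, c.inner u v = B u v) ∧
    letI := c.toNormedAddCommGroup
    CompleteSpace W

end

noncomputable section

open Filter Topology
open scoped ENNReal NNReal

/-! ### Local parametrizations and null sets -/

/-! Send `u` to the pair `(u, U)` in `L² × L²`. The form is the pullback of the Hilbert inner
product along this injective linear map, so each space is complete as soon as its graph is closed
(`IsHilbertSpaceWith.of_linearMap`).

Closedness is not immediate, because `U = Q ∇u`, with `Q` one of `P_τ`, `P_n`, sees only part of the
derivative. With `P = 1 - Q`, the missing part is of order zero: the field satisfies `P u = 0`, and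
differentiation gives `P ∂u = -(∂P) u`. Hence `∂(u ∘ m) = U ∂m - ∂(P ∘ m) u` in a local
parametrization (`IsWeakJacobian.eq_compressed_sub`). The coefficients are continuous, so the right
side depends continuously on `(u, U)`, and the weak derivative identity survives `L²` limits
(`isWeakJacobian_of_tendsto`). Along an a.e. convergent subsequence, the pointwise limit of the full
gradients is a surface gradient in all parametrizations at once
(`IsCompressedGradient.exists_of_tendsto_ae`).

The graph for `H¹(M)` is the sum of the tangential and the normal graph
(`range_graphMap_isProjectedGradient`). These are orthogonal since `P_τ` and `P_n` have orthogonal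
ranges on `M`, and a sum of two orthogonal closed subspaces is closed.

Local parametrizations are locally bi-Lipschitz. This alone carries null sets between surface and
Lebesgue measure in both directions and pulls `L²` fields back to `L¹_loc`; no area formula is used.
-/

lemma exists_antilipschitz_of_hasStrictFDerivAt {E F : Type*} [NormedAddCommGroup E]
    [NormedSpace ℝ E] [FiniteDimensional ℝ E] [NormedAddCommGroup F] [NormedSpace ℝ F]
    {f : E → F} {L : E →L[ℝ] F} {a : E} (hf : HasStrictFDerivAt f L a)
    (hL : Function.Injective L) :
    ∃ s ∈ 𝓝 a, ∃ K : ℝ≥0, ∀ x ∈ s, ∀ y ∈ s, edist x y ≤ K * edist (f x) (f y) := by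
  obtain ⟨K, K0, hK⟩ := LinearMap.exists_antilipschitzWith (L : E →ₗ[ℝ] F)
    (LinearMap.ker_eq_bot.2 hL)
  -- With this error constant, `K` times the linearization error is at most half of `‖x - y‖` and is
  -- absorbed, which doubles the constant.
  have hc : 0 < (2 * K)⁻¹ := by positivity
  obtain ⟨s, hs, happ⟩ := hf.approximates_deriv_on_nhds (Or.inr hc)
  refine ⟨s, hs, 2 * K, fun x hx y hy => ?_⟩
  have h1 := happ x hx y hy
  have h2 : ‖x - y‖ ≤ K * ‖L (x - y)‖ := by
    have := hK.le_mul_dist x y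
    simpa [dist_eq_norm] using this
  have h3 : ‖L (x - y)‖ ≤ ‖f x - f y‖ + ‖f x - f y - L (x - y)‖ := by
    have := norm_sub_le (f x - f y) (f x - f y - L (x - y))
    simpa using this
  have hKr : (0 : ℝ) < K := K0
  have h4 : (K : ℝ) * ‖f x - f y - L (x - y)‖ ≤ ‖x - y‖ / 2 := by
    calc (K : ℝ) * ‖f x - f y - L (x - y)‖ ≤ K * (((2 * K)⁻¹ : ℝ≥0) * ‖x - y‖) := by gcongr
      _ = ‖x - y‖ / 2 := by
        push_cast
        field_simp
  have h5 : ‖x - y‖ ≤ 2 * K * ‖f x - f y‖ := by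
    nlinarith [mul_le_mul_of_nonneg_left h3 hKr.le]
  have h6 : nndist x y ≤ 2 * K * nndist (f x) (f y) := by
    rw [← NNReal.coe_le_coe]
    simpa [dist_eq_norm] using h5
  rw [edist_nndist, edist_nndist]
  exact_mod_cast h6

/-- The inverse of `f` on `f '' A` is `K`-Lipschitz. The normalizing factor depends on `d` only, so
it is the same on both sides. -/
lemma euclideanHausdorffMeasure_le_image {X Y : Type*} [MetricSpace X] [MeasurableSpace X]
    [BorelSpace X] [MetricSpace Y] [MeasurableSpace Y] [BorelSpace Y] (d : ℕ) {f : X → Y}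
    {A : Set X} {K : ℝ≥0} (h : ∀ x ∈ A, ∀ y ∈ A, edist x y ≤ K * edist (f x) (f y)) :
    μHE[d] A ≤ (K : ℝ≥0∞) ^ (d : ℝ) * μHE[d] (f '' A) := by
  rcases A.eq_empty_or_nonempty with rfl | hne
  · simp
  obtain ⟨x0, -⟩ := id hne
  have : Nonempty X := ⟨x0⟩
  have hinj : Set.InjOn f A := fun x hx y hy hxy => by
    have := h x hx y hy
    rw [hxy] at this
    simpa using this
  have hlip : LipschitzOnWith K (Function.invFunOn f A) (f '' A) := by
    rintro _ ⟨x, hx, rfl⟩ _ ⟨y, hy, rfl⟩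
    rw [hinj.leftInvOn_invFunOn hx, hinj.leftInvOn_invFunOn hy]
    exact h x hx y hy
  have him : Function.invFunOn f A '' (f '' A) = A := hinj.leftInvOn_invFunOn.image_image
  have := hlip.hausdorffMeasure_image_le (d := d) (by positivity)
  rw [him] at this
  simp only [Measure.euclideanHausdorffMeasure_def, Measure.smul_apply, ENNReal.smul_def,
    smul_eq_mul]
  calc _ ≤ _ * ((K : ℝ≥0∞) ^ (d : ℝ) * μH[d] (f '' A)) := by gcongr
    _ = _ := by ring

lemma euclideanHausdorffMeasure_image_eq_zero {X Y : Type*} [MetricSpace X] [MeasurableSpace X]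
    [BorelSpace X] [MetricSpace Y] [MeasurableSpace Y] [BorelSpace Y] (d : ℕ) {f : X → Y}
    {A : Set X} {K : ℝ≥0} (h : LipschitzOnWith K f A) (hA : μHE[d] A = 0) :
    μHE[d] (f '' A) = 0 := by
  have := h.hausdorffMeasure_image_le (d := d) (by positivity)
  rw [Measure.euclideanHausdorffMeasure_def, Measure.smul_apply, ENNReal.smul_def, smul_eq_mul,
    mul_eq_zero] at hA ⊢
  rcases hA with hA | hA
  · exact Or.inl hA
  · right
    simpa [hA] using this

section Patch

variable {d : ℕ} {M : Set (Euc (d + 1))} {Ω : Set (Euc d)} {m : Euc d → Euc (d + 1)}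

lemma IsPatch.contDiffAt (h : IsPatch M Ω m) {ζ : Euc d} (hζ : ζ ∈ Ω) : ContDiffAt ℝ 1 m ζ :=
  h.contDiffOn.contDiffAt (h.isOpen.mem_nhds hζ)

lemma IsPatch.mem (h : IsPatch M Ω m) {ζ : Euc d} (hζ : ζ ∈ Ω) : m ζ ∈ M := by
  obtain ⟨U, -, hU⟩ := h.relOpen
  have : m ζ ∈ M ∩ U := hU ▸ Set.mem_image_of_mem m hζ
  exact this.1

lemma IsPatch.injOn (h : IsPatch M Ω m) : Set.InjOn m Ω :=
  Set.injOn_iff_injective.2 h.isEmbedding.injective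

lemma IsPatch.continuousOn_fderiv (h : IsPatch M Ω m) : ContinuousOn (fderiv ℝ m) Ω :=
  h.contDiffOn.continuousOn_fderiv_of_isOpen h.isOpen le_rfl

/-- On compact subsets of the parameter domain, Lebesgue measure is dominated by the surface
measure of the image. -/
lemma IsPatch.exists_volume_le (h : IsPatch M Ω m) {K : Set (Euc d)} (hK : IsCompact K)
    (hKΩ : K ⊆ Ω) :
    ∃ C : ℝ≥0, ∀ A ⊆ K, volume A ≤ C * μHE[d] (m '' A) := by
  -- The antilipschitz constant of `m` is only local; compactness leaves finitely many pieces, whose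
  -- constants add up.
  refine hK.induction_on (p := fun K => ∃ C : ℝ≥0, ∀ A ⊆ K, volume A ≤ C * μHE[d] (m '' A))
    ⟨0, fun A hA => by simp [Set.subset_empty_iff.1 hA]⟩ ?_ ?_ ?_
  · rintro s t hst ⟨C, hC⟩
    exact ⟨C, fun A hA => hC A (hA.trans hst)⟩
  · rintro s t ⟨C, hC⟩ ⟨C', hC'⟩
    refine ⟨C + C', fun A hA => ?_⟩
    have hA' : A = (A ∩ s) ∪ (A ∩ t) := by
      rw [← Set.inter_union_distrib_left, Set.inter_eq_left.2 hA]
    calc volume A = volume ((A ∩ s) ∪ (A ∩ t)) := by rw [← hA']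
      _ ≤ volume (A ∩ s) + volume (A ∩ t) := measure_union_le _ _
      _ ≤ C * μHE[d] (m '' (A ∩ s)) + C' * μHE[d] (m '' (A ∩ t)) :=
        add_le_add (hC _ Set.inter_subset_right) (hC' _ Set.inter_subset_right)
      _ ≤ C * μHE[d] (m '' A) + C' * μHE[d] (m '' A) := by
        gcongr <;> exact Set.inter_subset_left
      _ = _ := by push_cast; ring
  · intro ζ hζ
    obtain ⟨s, hs, k, hk⟩ := exists_antilipschitz_of_hasStrictFDerivAt
      ((h.contDiffAt (hKΩ hζ)).hasStrictFDerivAt one_ne_zero) (h.injective_fderiv ζ (hKΩ hζ))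
    refine ⟨s, mem_nhdsWithin_of_mem_nhds hs, k ^ (d : ℝ), fun A hA => ?_⟩
    have := euclideanHausdorffMeasure_le_image d
      (fun x hx y hy => hk x (hA hx) y (hA hy))
    rw [EuclideanSpace.euclideanHausdorffMeasure_eq_volume] at this
    rwa [← ENNReal.coe_rpow_of_nonneg _ (by positivity)] at this

/-- Lusin–Souslin: a continuous injective image of a Borel set is Borel. -/
lemma IsPatch.measurableSet_image (h : IsPatch M Ω m) : MeasurableSet (m '' Ω) :=
  h.isOpen.measurableSet.image_of_continuousOn_injOn h.contDiffOn.continuousOn h.injOn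

/-- By second countability, countably many patches cover `M`, and each of them is Borel. -/
lemma IsHypersurface.measurableSet (hM : IsHypersurface M) : MeasurableSet M := by
  have key : ∀ x ∈ M, ∃ V ∈ 𝓝[M] x, V ⊆ M ∧ MeasurableSet V := by
    intro x hx
    obtain ⟨Ω, m, hm, hxm⟩ := hM x hx
    obtain ⟨U, hU, hUM⟩ := hm.relOpen
    refine ⟨m '' Ω, ?_, ?_, hm.measurableSet_image⟩
    · rw [hUM] at hxm ⊢
      exact inter_mem self_mem_nhdsWithin (mem_nhdsWithin_of_mem_nhds (hU.mem_nhds hxm.2))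
    · rw [hUM]
      exact Set.inter_subset_left
  choose! V hV hVM hVmeas using key
  obtain ⟨t, htM, htc, htV⟩ := TopologicalSpace.countable_cover_nhdsWithin hV
  have : M = ⋃ x ∈ t, V x :=
    htV.antisymm (Set.iUnion₂_subset fun x hx => hVM x (htM hx))
  rw [this]
  exact MeasurableSet.biUnion htc fun x hx => hVmeas x (htM hx)

lemma IsPatch.aemeasurable (h : IsPatch M Ω m) {K : Set (Euc d)} (hK : MeasurableSet K)
    (hKΩ : K ⊆ Ω) : AEMeasurable m (volume.restrict K) :=
  (h.contDiffOn.continuousOn.mono hKΩ).aemeasurable hK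

/-- This one-sided domination is the substitute for the area formula: it suffices for pulling a.e.
statements and `L²` bounds back from `M`. -/
lemma IsPatch.exists_map_le (h : IsPatch M Ω m) {K : Set (Euc d)} (hK : IsCompact K)
    (hKΩ : K ⊆ Ω) :
    ∃ C : ℝ≥0, (volume.restrict K).map m ≤ C • surfaceMeasure M := by
  obtain ⟨C, hC⟩ := h.exists_volume_le hK hKΩ
  refine ⟨C, Measure.le_iff.2 fun s hs => ?_⟩
  rw [Measure.map_apply_of_aemeasurable (h.aemeasurable hK.measurableSet hKΩ) hs,
    Measure.restrict_apply' hK.measurableSet, Measure.smul_apply, surfaceMeasure,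
    Measure.restrict_apply hs, ENNReal.smul_def, smul_eq_mul]
  refine (hC _ Set.inter_subset_right).trans ?_
  gcongr
  rintro _ ⟨ζ, ⟨h1, h2⟩, rfl⟩
  exact ⟨h1, h.mem (hKΩ h2)⟩

lemma IsPatch.ae_comp_of_isCompact (h : IsPatch M Ω m) {K : Set (Euc d)} (hK : IsCompact K)
    (hKΩ : K ⊆ Ω) {p : Euc (d + 1) → Prop} (hp : ∀ᵐ x ∂(surfaceMeasure M), p x) :
    ∀ᵐ ζ ∂(volume.restrict K), p (m ζ) := by
  obtain ⟨C, hC⟩ := h.exists_map_le hK hKΩ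
  refine ae_of_ae_map (h.aemeasurable hK.measurableSet hKΩ) ?_
  exact (Measure.absolutelyContinuous_of_le_smul (c := C) hC) hp

lemma ae_restrict_of_forall_isCompact {p : Euc d → Prop} (hΩ : IsOpen Ω)
    (h : ∀ K ⊆ Ω, IsCompact K → ∀ᵐ ζ ∂(volume.restrict K), p ζ) :
    ∀ᵐ ζ ∂(volume.restrict Ω), p ζ := by
  rw [ae_restrict_iff' hΩ.measurableSet, ae_iff]
  refine measure_null_of_locally_null _ fun x hx => ?_
  simp only [Classical.not_imp, Set.mem_ofPred_eq] at hx
  obtain ⟨K, hK, hxK, hKΩ⟩ := exists_compact_subset hΩ hx.1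
  refine ⟨{ζ | ζ ∈ K ∧ ¬ p ζ}, ?_, ?_⟩
  · have h1 : K ∈ 𝓝 x := mem_interior_iff_mem_nhds.1 hxK
    filter_upwards [mem_nhdsWithin_of_mem_nhds h1, self_mem_nhdsWithin] with ζ h2 h3
    simp only [Classical.not_imp] at h3
    exact ⟨h2, h3.2⟩
  · have := h K hKΩ hK
    rw [ae_restrict_iff' hK.measurableSet, ae_iff] at this
    simpa only [Classical.not_imp] using this

lemma IsPatch.ae_comp (h : IsPatch M Ω m) {p : Euc (d + 1) → Prop}
    (hp : ∀ᵐ x ∂(surfaceMeasure M), p x) : ∀ᵐ ζ ∂(volume.restrict Ω), p (m ζ) :=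
  ae_restrict_of_forall_isCompact h.isOpen fun _ hKΩ hK => h.ae_comp_of_isCompact hK hKΩ hp

lemma IsPatch.image_null (h : IsPatch M Ω m) {N : Set (Euc d)} (hNΩ : N ⊆ Ω)
    (hN : volume N = 0) : μHE[d] (m '' N) = 0 := by
  -- `A ↦ μHE[d] (m '' A)` is an outer measure, so its vanishing on `N` may be checked near each
  -- point, where `m` is Lipschitz.
  have := measure_null_of_locally_null
    (μ := OuterMeasure.comap m (μHE[d] : Measure (Euc (d + 1))).toOuterMeasure) N ?_
  · simpa using this
  intro x hx
  obtain ⟨K, t, ht, hK⟩ := (h.contDiffAt (hNΩ hx)).exists_lipschitzOnWith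
  refine ⟨N ∩ t, inter_mem self_mem_nhdsWithin (mem_nhdsWithin_of_mem_nhds ht), ?_⟩
  have := euclideanHausdorffMeasure_image_eq_zero d (hK.mono (Set.inter_subset_right (s := N)))
    (by rw [EuclideanSpace.euclideanHausdorffMeasure_eq_volume]
        exact measure_mono_null Set.inter_subset_left hN)
  simpa using this

/-- Converse of `IsPatch.ae_comp`: near a point of a patch, the exceptional set lies in the image of
a Lebesgue null set, which is null by `IsPatch.image_null`. -/
lemma ae_surfaceMeasure_of_forall_isPatch (hM : IsHypersurface M) {p : Euc (d + 1) → Prop}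
    (hp : ∀ (Ω : Set (Euc d)) (m : Euc d → Euc (d + 1)), IsPatch M Ω m →
      ∀ᵐ ζ ∂(volume.restrict Ω), p (m ζ)) :
    ∀ᵐ x ∂(surfaceMeasure M), p x := by
  rw [surfaceMeasure, ae_restrict_iff' hM.measurableSet, ae_iff]
  refine measure_null_of_locally_null _ fun x hx => ?_
  simp only [Classical.not_imp, Set.mem_ofPred_eq] at hx
  obtain ⟨Ω, m, hm, hxm⟩ := hM x hx.1
  obtain ⟨U, hU, hUM⟩ := hm.relOpen
  have hnull := hp Ω m hm
  rw [ae_restrict_iff' hm.isOpen.measurableSet, ae_iff] at hnull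
  refine ⟨_, ?_, hm.image_null (N := {ζ | ¬(ζ ∈ Ω → p (m ζ))}) (fun ζ hζ => ?_) hnull⟩
  · rw [hUM] at hxm
    filter_upwards [self_mem_nhdsWithin, mem_nhdsWithin_of_mem_nhds (hU.mem_nhds hxm.2)]
      with y hy1 hy2
    simp only [Classical.not_imp] at hy1
    have : y ∈ m '' Ω := hUM ▸ ⟨hy1.1, hy2⟩
    obtain ⟨ζ, hζ, rfl⟩ := this
    exact ⟨ζ, by simpa using ⟨hζ, hy1.2⟩, rfl⟩
  · simp only [Classical.not_imp, Set.mem_ofPred_eq] at hζ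
    exact hζ.1

lemma ae_mem_of_isHypersurface (hM : IsHypersurface M) : ∀ᵐ x ∂(surfaceMeasure M), x ∈ M :=
  ae_restrict_mem hM.measurableSet

/-! ### Square integrable fields in local parametrizations -/

lemma IsPatch.aestronglyMeasurable_comp {F : Type*} [NormedAddCommGroup F] (h : IsPatch M Ω m)
    {K : Set (Euc d)} (hK : IsCompact K) (hKΩ : K ⊆ Ω) {g : Euc (d + 1) → F}
    (hg : AEStronglyMeasurable g (surfaceMeasure M)) :
    AEStronglyMeasurable (fun ζ => g (m ζ)) (volume.restrict K) := by
  obtain ⟨C, hC⟩ := h.exists_map_le hK hKΩ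
  have h1 : AEStronglyMeasurable g ((volume.restrict K).map m) :=
    hg.mono_ac (Measure.absolutelyContinuous_of_le_smul (c := C) hC)
  exact h1.comp_aemeasurable (h.aemeasurable hK.measurableSet hKΩ)

/-- Hölder on `K`, which has finite volume, followed by the domination of measures. The constant is
independent of `g`, so `L²` convergence on `M` becomes `L¹` convergence on `K`. -/
lemma IsPatch.exists_eLpNorm_comp_le {F : Type*} [NormedAddCommGroup F] (h : IsPatch M Ω m)
    {K : Set (Euc d)} (hK : IsCompact K) (hKΩ : K ⊆ Ω) :
    ∃ C : ℝ≥0∞, C ≠ ∞ ∧ ∀ g : Euc (d + 1) → F, AEStronglyMeasurable g (surfaceMeasure M) →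
      eLpNorm (fun ζ => g (m ζ)) 1 (volume.restrict K) ≤ C * eLpNorm g 2 (surfaceMeasure M) := by
  obtain ⟨C, hC⟩ := h.exists_map_le hK hKΩ
  refine ⟨(C : ℝ≥0∞) ^ (1 / (2 : ℝ≥0∞).toReal) *
    (volume.restrict K) Set.univ ^ (1 / (1 : ℝ≥0∞).toReal - 1 / (2 : ℝ≥0∞).toReal), ?_, ?_⟩
  · refine ENNReal.mul_ne_top (ENNReal.rpow_ne_top_of_nonneg (by positivity) ENNReal.coe_ne_top)
      (ENNReal.rpow_ne_top_of_nonneg (by norm_num) ?_)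
    simpa using hK.measure_lt_top.ne
  · intro g hg
    have hmeas := h.aestronglyMeasurable_comp hK hKΩ hg
    have h1 : AEStronglyMeasurable g ((volume.restrict K).map m) :=
      hg.mono_ac (Measure.absolutelyContinuous_of_le_smul (c := C) hC)
    have h2 : eLpNorm (fun ζ => g (m ζ)) 2 (volume.restrict K)
        = eLpNorm g 2 ((volume.restrict K).map m) :=
      (eLpNorm_map_measure h1 (h.aemeasurable hK.measurableSet hKΩ)).symm
    have h3 : eLpNorm g 2 ((volume.restrict K).map m)
        ≤ (C : ℝ≥0∞) ^ (1 / (2 : ℝ≥0∞).toReal) * eLpNorm g 2 (surfaceMeasure M) := by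
      refine (eLpNorm_mono_measure g hC).trans (le_of_eq ?_)
      rw [← Measure.coe_nnreal_smul, eLpNorm_smul_measure_of_ne_top (by norm_num), smul_eq_mul,
        ENNReal.toReal_div, ENNReal.toReal_one]
    calc _ ≤ eLpNorm (fun ζ => g (m ζ)) 2 (volume.restrict K) * _ :=
          eLpNorm_le_eLpNorm_mul_rpow_measure_univ (by norm_num) hmeas
      _ ≤ ((C : ℝ≥0∞) ^ (1 / (2 : ℝ≥0∞).toReal) * eLpNorm g 2 (surfaceMeasure M)) * _ := by
          rw [h2]; gcongr
      _ = _ := by ring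

lemma IsPatch.locallyIntegrableOn_comp {F : Type*} [NormedAddCommGroup F] (h : IsPatch M Ω m)
    {g : Euc (d + 1) → F} (hg : MemLp g 2 (surfaceMeasure M)) :
    LocallyIntegrableOn (fun ζ => g (m ζ)) Ω := by
  rw [locallyIntegrableOn_iff h.isOpen.isLocallyClosed]
  intro K hKΩ hK
  obtain ⟨C, hC, hle⟩ := h.exists_eLpNorm_comp_le (F := F) hK hKΩ
  have : MemLp (fun ζ => g (m ζ)) 1 (volume.restrict K) :=
    ⟨h.aestronglyMeasurable_comp hK hKΩ hg.1,
      (hle g hg.1).trans_lt (ENNReal.mul_lt_top hC.lt_top hg.2)⟩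
  exact memLp_one_iff_integrable.1 this

end Patch

/-! ### Weak Jacobians -/

section Weak

variable {d k : ℕ} {Ω : Set (Euc d)}

lemma LocallyIntegrableOn.clm_apply_of_continuousOn {F G : Type*} [NormedAddCommGroup F]
    [NormedSpace ℝ F] [NormedAddCommGroup G] [NormedSpace ℝ G] (hΩ : IsOpen Ω)
    {ψ : Euc d → (F →L[ℝ] G)} (hψ : ContinuousOn ψ Ω) {g : Euc d → F}
    (hg : LocallyIntegrableOn g Ω) : LocallyIntegrableOn (fun ζ => ψ ζ (g ζ)) Ω := by
  rw [locallyIntegrableOn_iff hΩ.isLocallyClosed] at hg ⊢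
  intro K hKΩ hK
  obtain ⟨C, hC⟩ := hK.exists_bound_of_continuousOn (hψ.mono hKΩ)
  have hgK := hg K hKΩ hK
  have hmeas : AEStronglyMeasurable ψ (volume.restrict K) :=
    (hψ.mono hKΩ).aestronglyMeasurable_of_isCompact hK hK.measurableSet
  refine Integrable.mono' (hgK.norm.const_mul C) ?_ ?_
  · exact (ContinuousLinearMap.id ℝ (F →L[ℝ] G)).aestronglyMeasurable_comp₂ hmeas hgK.1
  · filter_upwards [ae_restrict_mem hK.measurableSet] with ζ hζ
    exact (ψ ζ).le_of_opNorm_le (hC ζ hζ) (g ζ)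

lemma setIntegral_testFunction_smul {F : Type*} [NormedAddCommGroup F] [NormedSpace ℝ F]
    {φ : Euc d → ℝ} (hs : tsupport φ ⊆ Ω) (f : Euc d → F) :
    ∫ ζ in Ω, φ ζ • f ζ = ∫ ζ, φ ζ • f ζ := by
  refine setIntegral_eq_integral_of_forall_compl_eq_zero fun ζ hζ => ?_
  rw [image_eq_zero_of_notMem_tsupport fun h => hζ (hs h), zero_smul]

lemma ae_eq_zero_of_forall_testFunction {F : Type*} [NormedAddCommGroup F] [NormedSpace ℝ F]
    [CompleteSpace F] (hΩ : IsOpen Ω) {f : Euc d → F} (hf : LocallyIntegrableOn f Ω)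
    (h : ∀ φ : Euc d → ℝ, ContDiff ℝ 1 φ → HasCompactSupport φ → tsupport φ ⊆ Ω →
      ∫ ζ in Ω, φ ζ • f ζ = 0) :
    ∀ᵐ ζ ∂(volume.restrict Ω), f ζ = 0 := by
  rw [ae_restrict_iff' hΩ.measurableSet]
  refine hΩ.ae_eq_zero_of_integral_contDiff_smul_eq_zero hf fun φ hφ hc hs => ?_
  rw [← setIntegral_testFunction_smul hs]
  exact h φ (hφ.of_le (by exact_mod_cast le_top)) hc hs

lemma IsWeakJacobian.congr {u v : Euc d → Euc k}
    {D E : Euc d → (Euc d →L[ℝ] Euc k)} (hu : IsWeakJacobian Ω u D)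
    (huv : u =ᵐ[volume.restrict Ω] v) (hDE : D =ᵐ[volume.restrict Ω] E) :
    IsWeakJacobian Ω v E where
  locallyIntegrableOn := LocallyIntegrableOn.congr huv hu.locallyIntegrableOn
  locallyIntegrableOn_deriv := LocallyIntegrableOn.congr hDE hu.locallyIntegrableOn_deriv
  integral_eq := by
    intro φ hφ hc hs w
    have h1 : ∫ ζ in Ω, (fderiv ℝ φ ζ w) • v ζ = ∫ ζ in Ω, (fderiv ℝ φ ζ w) • u ζ :=
      integral_congr_ae (by filter_upwards [huv] with ζ h; rw [h])
    have h2 : ∫ ζ in Ω, φ ζ • E ζ w = ∫ ζ in Ω, φ ζ • D ζ w :=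
      integral_congr_ae (by filter_upwards [hDE] with ζ h; rw [h])
    rw [h1, h2, hu.integral_eq φ hφ hc hs w]

/-- The exceptional null set may depend on `v`, but only the finitely many basis vectors matter. -/
lemma ae_clm_eq_zero {l : Filter (Euc d)} [CountableInterFilter l] {j : ℕ} {F : Type*}
    [NormedAddCommGroup F] [NormedSpace ℝ F] {D : Euc d → (Euc j →L[ℝ] F)}
    (h : ∀ v, ∀ᶠ ζ in l, D ζ v = 0) : ∀ᶠ ζ in l, D ζ = 0 := by
  have : ∀ᶠ ζ in l, ∀ i : Fin j, D ζ (EuclideanSpace.single i 1) = 0 :=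
    eventually_countable_forall.2 fun i => h _
  filter_upwards [this] with ζ hζ
  refine ContinuousLinearMap.coe_injective ((EuclideanSpace.basisFun (Fin j) ℝ).toBasis.ext ?_)
  intro i
  simpa using hζ i

/-- Uniqueness of weak derivatives. -/
lemma IsWeakJacobian.ae_eq (hΩ : IsOpen Ω) {u v : Euc d → Euc k}
    {D E : Euc d → (Euc d →L[ℝ] Euc k)} (hu : IsWeakJacobian Ω u D) (hv : IsWeakJacobian Ω v E)
    (huv : u =ᵐ[volume.restrict Ω] v) : D =ᵐ[volume.restrict Ω] E := by
  have hv' := hv.congr huv.symm (ae_eq_refl E)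
  -- `E` is a weak Jacobian of `u` too, so `D - E` belongs to `u - u = 0`.
  have hsub := hu.add (hv'.const_smul (-1))
  have h0 : ∀ᵐ ζ ∂(volume.restrict Ω), D ζ + (-1 : ℝ) • E ζ = 0 := by
    refine ae_clm_eq_zero fun w => ?_
    refine ae_eq_zero_of_forall_testFunction hΩ
      (f := fun ζ => (D ζ + (-1 : ℝ) • E ζ) w) ?_ fun φ hφ hc hs => ?_
    · exact LocallyIntegrableOn.clm_apply_of_continuousOn hΩ
        (ψ := fun _ => ContinuousLinearMap.apply ℝ (Euc k) w) continuousOn_const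
        hsub.locallyIntegrableOn_deriv
    · have := hsub.integral_eq φ hφ hc hs w
      rw [← neg_eq_iff_eq_neg] at this
      rw [← this]
      simp
  filter_upwards [h0] with ζ hζ
  exact sub_eq_zero.1 (by rw [← hζ]; module)

lemma contDiff_smul_of_tsupport_subset {F : Type*} [NormedAddCommGroup F] [NormedSpace ℝ F]
    (hΩ : IsOpen Ω) {φ : Euc d → ℝ} (hφ : ContDiff ℝ 1 φ) (hs : tsupport φ ⊆ Ω)
    {Q : Euc d → F} (hQ : ContDiffOn ℝ 1 Q Ω) : ContDiff ℝ 1 (fun ζ => φ ζ • Q ζ) := by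
  rw [contDiff_iff_contDiffAt]
  intro ζ
  by_cases hζ : ζ ∈ Ω
  · exact hφ.contDiffAt.smul (hQ.contDiffAt (hΩ.mem_nhds hζ))
  · have h0 : φ =ᶠ[𝓝 ζ] 0 := notMem_tsupport_iff_eventuallyEq.1 fun h => hζ (hs h)
    refine (contDiffAt_const (c := (0 : F))).congr_of_eventuallyEq ?_
    filter_upwards [h0] with x hx
    simp [hx]

/-- The defining identity of the weak Jacobian, tested with covector valued functions. -/
lemma IsWeakJacobian.integral_clm_eq {u : Euc d → Euc k} {D : Euc d → (Euc d →L[ℝ] Euc k)}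
    (hu : IsWeakJacobian Ω u D) {Ψ : Euc d → (Euc k →L[ℝ] ℝ)} (hΨ : ContDiff ℝ 1 Ψ)
    (hc : HasCompactSupport Ψ) (hs : tsupport Ψ ⊆ Ω) (v : Euc d) :
    ∫ ζ in Ω, (fderiv ℝ Ψ ζ v) (u ζ) = - ∫ ζ in Ω, Ψ ζ (D ζ v) := by
  -- Each coefficient of `Ψ` is a scalar test function; its identity is read off in the matching
  -- component of `u`, and the results are summed.
  set φ : Fin k → Euc d → ℝ := fun j ζ => Ψ ζ (EuclideanSpace.single j 1) with hφdef
  have hφ : ∀ j, ContDiff ℝ 1 (φ j) := fun j => hΨ.clm_apply contDiff_const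
  have hsub : ∀ j, tsupport (φ j) ⊆ tsupport Ψ := fun j =>
    tsupport_comp_subset (g := fun L : Euc k →L[ℝ] ℝ => L (EuclideanSpace.single j 1)) rfl _
  have hcφ : ∀ j, HasCompactSupport (φ j) := fun j =>
    hc.of_isClosed_subset (isClosed_tsupport _) (hsub j)
  have hexp : ∀ (L : Euc k →L[ℝ] ℝ) (y : Euc k),
      L y = ∑ j, L (EuclideanSpace.single j 1) * y j := by
    intro L y
    conv_lhs => rw [← (EuclideanSpace.basisFun (Fin k) ℝ).sum_repr y]
    simp [mul_comm]
  have hder : ∀ j ζ, fderiv ℝ (φ j) ζ v = (fderiv ℝ Ψ ζ v) (EuclideanSpace.single j 1) := by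
    intro j ζ
    have := ((hΨ.differentiable one_ne_zero ζ).hasFDerivAt.clm_apply
      (hasFDerivAt_const (EuclideanSpace.single j (1 : ℝ)) ζ)).fderiv
    rw [hφdef, this]
    simp
  have hj : ∀ j, ∫ ζ in Ω, fderiv ℝ (φ j) ζ v * u ζ j = - ∫ ζ in Ω, φ j ζ * D ζ v j := by
    intro j
    have h1 := hu.integral_eq (φ j) (hφ j) (hcφ j) ((hsub j).trans hs) v
    obtain ⟨i1, i2⟩ := integrable_testFunction hu (hφ j) (hcφ j) ((hsub j).trans hs) v
    have h2 := congrArg (EuclideanSpace.proj j : Euc k →L[ℝ] ℝ) h1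
    rw [map_neg, ← ContinuousLinearMap.integral_comp_comm _ i1,
      ← ContinuousLinearMap.integral_comp_comm _ i2] at h2
    simpa using h2
  have hint1 : ∀ j, Integrable (fun ζ => fderiv ℝ (φ j) ζ v * u ζ j) (volume.restrict Ω) := by
    intro j
    have := (integrable_testFunction hu (hφ j) (hcφ j) ((hsub j).trans hs) v).1
    simpa using (EuclideanSpace.proj j : Euc k →L[ℝ] ℝ).integrable_comp this
  have hint2 : ∀ j, Integrable (fun ζ => φ j ζ * D ζ v j) (volume.restrict Ω) := by
    intro j
    have := (integrable_testFunction hu (hφ j) (hcφ j) ((hsub j).trans hs) v).2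
    simpa using (EuclideanSpace.proj j : Euc k →L[ℝ] ℝ).integrable_comp this
  calc ∫ ζ in Ω, (fderiv ℝ Ψ ζ v) (u ζ)
      = ∫ ζ in Ω, ∑ j, fderiv ℝ (φ j) ζ v * u ζ j := by
        refine integral_congr_ae (ae_of_all _ fun ζ => ?_)
        simp only [hder]
        exact hexp _ _
    _ = ∑ j, ∫ ζ in Ω, fderiv ℝ (φ j) ζ v * u ζ j := integral_finsetSum _ fun j _ => hint1 j
    _ = - ∑ j, ∫ ζ in Ω, φ j ζ * D ζ v j := by
        rw [← Finset.sum_neg_distrib]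
        exact Finset.sum_congr rfl fun j _ => hj j
    _ = - ∫ ζ in Ω, ∑ j, φ j ζ * D ζ v j := by
        rw [integral_finsetSum _ fun j _ => hint2 j]
    _ = - ∫ ζ in Ω, Ψ ζ (D ζ v) := by
        congr 1
        refine integral_congr_ae (ae_of_all _ fun ζ => ?_)
        exact (hexp _ _).symm

/-- If `P` is a `C¹` matrix field and `P u = 0`, then `P ∂ᵥu = -(∂ᵥP) u`. -/
lemma IsWeakJacobian.apply_eq_neg_fderiv_apply (hΩ : IsOpen Ω) {u : Euc d → Euc k}
    {D : Euc d → (Euc d →L[ℝ] Euc k)} (hu : IsWeakJacobian Ω u D)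
    {P : Euc d → (Euc k →L[ℝ] Euc k)} (hP : ContDiffOn ℝ 1 P Ω)
    (hPu : ∀ᵐ ζ ∂(volume.restrict Ω), P ζ (u ζ) = 0) :
    ∀ᵐ ζ ∂(volume.restrict Ω), ∀ v, P ζ (D ζ v) = -(fderiv ℝ P ζ v) (u ζ) := by
  have hdP : ContinuousOn (fderiv ℝ P) Ω := hP.continuousOn_fderiv_of_isOpen hΩ le_rfl
  -- Stated for linear maps in `v`, so that one null set serves all `v`.
  have h0 : ∀ᵐ ζ ∂(volume.restrict Ω), P ζ ∘L D ζ + (fderiv ℝ P ζ).flip (u ζ) = 0 := by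
    refine ae_clm_eq_zero fun v => ?_
    have l1 : LocallyIntegrableOn (fun ζ => P ζ (D ζ v)) Ω := by
      refine LocallyIntegrableOn.clm_apply_of_continuousOn hΩ hP.continuousOn ?_
      exact LocallyIntegrableOn.clm_apply_of_continuousOn hΩ
        (ψ := fun _ => ContinuousLinearMap.apply ℝ (Euc k) v) continuousOn_const
        hu.locallyIntegrableOn_deriv
    have l2 : LocallyIntegrableOn (fun ζ => (fderiv ℝ P ζ v) (u ζ)) Ω :=
      LocallyIntegrableOn.clm_apply_of_continuousOn hΩ (hdP.clm_apply continuousOn_const)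
        hu.locallyIntegrableOn
    refine ae_eq_zero_of_forall_testFunction hΩ
      (f := fun ζ => (P ζ ∘L D ζ + (fderiv ℝ P ζ).flip (u ζ)) v) (l1.add l2)
      fun φ hφ hc hs => ?_
    have i1 := integrable_testFunction_smul l1 hφ.continuous hc hs
    have i2 := integrable_testFunction_smul l2 hφ.continuous hc hs
    ext i
    set p : Euc k →L[ℝ] ℝ := EuclideanSpace.proj i
    -- The covector test function is `φ` times the `i`-th row of `P`.
    have hQ : ContDiffOn ℝ 1 (fun ζ => p ∘L P ζ) Ω := contDiffOn_const.clm_comp hP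
    have hsub : tsupport (fun ζ => φ ζ • (p ∘L P ζ)) ⊆ tsupport φ := by
      refine closure_mono fun ζ hζ h => hζ ?_
      simp only [h, zero_smul]
    have key := hu.integral_clm_eq (contDiff_smul_of_tsupport_subset hΩ hφ hs hQ)
      (hc.of_isClosed_subset (isClosed_tsupport _) hsub) (hsub.trans hs) v
    -- In the product rule, the term with `∂φ` contains `P u = 0`; only `φ (∂P) u` remains.
    have hl : ∫ ζ in Ω, (fderiv ℝ (fun ζ => φ ζ • (p ∘L P ζ)) ζ v) (u ζ)
        = ∫ ζ in Ω, p (φ ζ • (fderiv ℝ P ζ v) (u ζ)) := by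
      refine integral_congr_ae ?_
      filter_upwards [hPu, ae_restrict_mem hΩ.measurableSet] with ζ h1 hζ
      have hPd : HasFDerivAt P (fderiv ℝ P ζ) ζ :=
        ((hP.contDiffAt (hΩ.mem_nhds hζ)).differentiableAt one_ne_zero).hasFDerivAt
      have hd := ((hφ.differentiable one_ne_zero ζ).hasFDerivAt.smul
        ((hasFDerivAt_const p ζ).clm_comp hPd)).fderiv
      have hd' : fderiv ℝ (fun ζ => φ ζ • (p ∘L P ζ)) ζ = _ := hd
      rw [hd']
      simp [h1]
    have hsum : ∀ ζ, φ ζ • ((P ζ ∘L D ζ + (fderiv ℝ P ζ).flip (u ζ)) v)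
        = φ ζ • P ζ (D ζ v) + φ ζ • (fderiv ℝ P ζ v) (u ζ) := by
      intro ζ
      simp [smul_add]
    simp only [hsum]
    rw [integral_add i1 i2]
    change p (_ + _) = _
    rw [map_add, ← p.integral_comp_comm i1, ← p.integral_comp_comm i2, ← hl, key]
    simp
  filter_upwards [h0] with ζ hζ v
  have := congrArg (fun L : Euc d →L[ℝ] Euc k => L v) hζ
  simpa [eq_neg_iff_add_eq_zero] using this

end Weak

/-- If `LᵀL x = 0`, then `‖L x‖² = ⟪x, LᵀL x⟫ = 0`; so the Gram operator is injective and, in finite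
dimension, invertible, and `ContinuousLinearMap.inverse` is its true inverse. -/
lemma pinv_comp_self {d : ℕ} {L : Euc d →L[ℝ] Euc (d + 1)} (hL : Function.Injective L) :
    pinv L ∘L L = ContinuousLinearMap.id ℝ (Euc d) := by
  have hinj : Function.Injective (ContinuousLinearMap.adjoint L ∘L L : Euc d →L[ℝ] Euc d) := by
    rw [injective_iff_map_eq_zero]
    intro x hx
    apply hL
    rw [map_zero, ← inner_self_eq_zero (𝕜 := ℝ), ← ContinuousLinearMap.adjoint_inner_right]
    simp only [ContinuousLinearMap.comp_apply] at hx
    rw [hx, inner_zero_right]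
  let e : Euc d ≃L[ℝ] Euc d := (LinearEquiv.ofInjectiveEndo
    ((ContinuousLinearMap.adjoint L ∘L L : Euc d →L[ℝ] Euc d) : Euc d →ₗ[ℝ] Euc d)
    hinj).toContinuousLinearEquiv
  have he : (e : Euc d →L[ℝ] Euc d) = ContinuousLinearMap.adjoint L ∘L L := by
    ext x
    rfl
  rw [pinv, ContinuousLinearMap.comp_assoc, ← he, ContinuousLinearMap.inverse_equiv]
  ext x
  simp

/-! ### Closedness of the surface gradient -/

section Closed

variable {d : ℕ} {M : Set (Euc (d + 1))} {Ω : Set (Euc d)} {m : Euc d → Euc (d + 1)}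

lemma IsSurfaceGradient.ae_eq (hM : IsHypersurface M) {f g : Euc (d + 1) → Euc (d + 1)}
    {G H : Euc (d + 1) → (Euc (d + 1) →L[ℝ] Euc (d + 1))} (hf : IsSurfaceGradient M f G)
    (hg : IsSurfaceGradient M g H) (hfg : f =ᵐ[surfaceMeasure M] g) :
    G =ᵐ[surfaceMeasure M] H := by
  refine ae_surfaceMeasure_of_forall_isPatch hM fun Ω m hm => ?_
  obtain ⟨D, hD, hDG⟩ := hf Ω m hm
  obtain ⟨E, hE, hEH⟩ := hg Ω m hm
  filter_upwards [hDG, hEH, hD.ae_eq hm.isOpen hE (hm.ae_comp hfg)] with ζ h1 h2 h3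
  rw [h1, h2, h3]

lemma IsSurfaceGradient.congr_of_eqOn {f g : Euc (d + 1) → Euc (d + 1)}
    {G : Euc (d + 1) → (Euc (d + 1) →L[ℝ] Euc (d + 1))} (hf : IsSurfaceGradient M f G)
    (hfg : Set.EqOn f g M) : IsSurfaceGradient M g G := by
  intro Ω m hm
  obtain ⟨D, hD, hDG⟩ := hf Ω m hm
  refine ⟨D, hD.congr ?_ (ae_eq_refl D), hDG⟩
  filter_upwards [ae_restrict_mem hm.isOpen.measurableSet] with ζ hζ
  exact hfg (hm.mem hζ)

/-- On the compact support of `φ` the factor `φ • ψ` is bounded, and `L²` convergence on `M` gives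
`L¹` convergence there. -/
lemma IsPatch.tendsto_integral_smul_clm {F F' : Type*} [NormedAddCommGroup F] [NormedSpace ℝ F]
    [NormedAddCommGroup F'] [NormedSpace ℝ F'] [CompleteSpace F'] (h : IsPatch M Ω m)
    {φ : Euc d → ℝ}
    (hφ : Continuous φ) (hc : HasCompactSupport φ) (hs : tsupport φ ⊆ Ω)
    {ψ : Euc d → (F →L[ℝ] F')} (hψ : ContinuousOn ψ Ω) {g : ℕ → Euc (d + 1) → F}
    {g₀ : Euc (d + 1) → F} (hg : ∀ k, MemLp (g k) 2 (surfaceMeasure M))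
    (hg₀ : MemLp g₀ 2 (surfaceMeasure M))
    (hlim : Tendsto (fun k => eLpNorm (g k - g₀) 2 (surfaceMeasure M)) atTop (𝓝 0)) :
    Tendsto (fun k => ∫ ζ in Ω, φ ζ • ψ ζ (g k (m ζ))) atTop
      (𝓝 (∫ ζ in Ω, φ ζ • ψ ζ (g₀ (m ζ)))) := by
  have hint : ∀ {e : Euc (d + 1) → F}, MemLp e 2 (surfaceMeasure M) →
      Integrable (fun ζ => φ ζ • ψ ζ (e (m ζ))) (volume.restrict (tsupport φ)) := by
    intro e he
    have hloc := LocallyIntegrableOn.clm_apply_of_continuousOn h.isOpen hψ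
      (h.locallyIntegrableOn_comp he)
    exact (integrable_testFunction_smul hloc hφ hc hs).mono_measure
      (Measure.restrict_mono_set _ hs)
  simp only [setIntegral_testFunction_smul hs,
    ← setIntegral_testFunction_smul (φ := φ) (Ω := tsupport φ) subset_rfl]
  refine tendsto_integral_of_L1' _ (hint hg₀).1 (Eventually.of_forall fun k => hint (hg k)) ?_
  obtain ⟨C, hC⟩ := hc.isCompact.exists_bound_of_continuousOn
    (hφ.continuousOn.smul (hψ.mono hs))
  obtain ⟨C', hC', hle⟩ := h.exists_eLpNorm_comp_le (F := F) hc.isCompact hs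
  have hbound : ∀ k, eLpNorm ((fun ζ => φ ζ • ψ ζ (g k (m ζ))) - fun ζ => φ ζ • ψ ζ (g₀ (m ζ)))
      1 (volume.restrict (tsupport φ))
      ≤ ENNReal.ofReal C * (C' * eLpNorm (g k - g₀) 2 (surfaceMeasure M)) := by
    intro k
    refine (eLpNorm_le_mul_eLpNorm_of_ae_le_mul (g := fun ζ => (g k - g₀) (m ζ)) (c := C) ?_
      1).trans ?_
    · filter_upwards [ae_restrict_mem hc.isCompact.measurableSet] with ζ hζ
      have := (φ ζ • ψ ζ).le_of_opNorm_le (hC ζ hζ) ((g k - g₀) (m ζ))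
      simpa [smul_sub] using this
    · gcongr
      exact hle _ ((hg k).sub hg₀).1
  refine tendsto_of_tendsto_of_tendsto_of_le_of_le tendsto_const_nhds ?_ (fun _ => zero_le)
    hbound
  have := ENNReal.Tendsto.const_mul (a := ENNReal.ofReal C)
    (ENNReal.Tendsto.const_mul (a := C') hlim (Or.inr hC')) (Or.inr ENNReal.ofReal_ne_top)
  simpa using this

/-- `U = Q ∇_M u`, where `u` is (the class of) a field with values in the subspaces `S x`. -/
def IsCompressedGradient (M : Set (Euc (d + 1))) (S : Euc (d + 1) → Submodule ℝ (Euc (d + 1)))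
    (Q : Euc (d + 1) → (Euc (d + 1) →L[ℝ] Euc (d + 1)))
    (u : L2Fields M) (U : Euc (d + 1) → (Euc (d + 1) →L[ℝ] Euc (d + 1))) : Prop :=
  ∃ (f : Euc (d + 1) → Euc (d + 1)) (G : Euc (d + 1) → (Euc (d + 1) →L[ℝ] Euc (d + 1))),
    u =ᵐ[surfaceMeasure M] f ∧ (∀ x ∈ M, f x ∈ S x) ∧ IsSurfaceGradient M f G ∧
      U = fun x => Q x ∘L G x

variable {S : Euc (d + 1) → Submodule ℝ (Euc (d + 1))}
  {P Q : Euc (d + 1) → (Euc (d + 1) →L[ℝ] Euc (d + 1))}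

lemma IsCompressedGradient.ae_eq (hM : IsHypersurface M) {u : L2Fields M}
    {U V : Euc (d + 1) → (Euc (d + 1) →L[ℝ] Euc (d + 1))} (hU : IsCompressedGradient M S Q u U)
    (hV : IsCompressedGradient M S Q u V) : U =ᵐ[surfaceMeasure M] V := by
  obtain ⟨f, G, h1, -, h3, rfl⟩ := hU
  obtain ⟨g, H, k1, -, k3, rfl⟩ := hV
  filter_upwards [h3.ae_eq hM k3 (h1.symm.trans k1)] with x hx
  rw [hx]

/-- The part of the weak Jacobian that is killed by `Q = 1 - P` is of order zero if `P f = 0`. -/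
lemma IsWeakJacobian.eq_compressed_sub (h : IsPatch M Ω m) (hQ : ∀ x, Q x + P x = 1)
    (hPS : ∀ x ∈ M, ∀ y ∈ S x, P x y = 0) (hP : ContDiffOn ℝ 1 (P ∘ m) Ω)
    {f : Euc (d + 1) → Euc (d + 1)} (hf : ∀ x ∈ M, f x ∈ S x)
    {D : Euc d → (Euc d →L[ℝ] Euc (d + 1))} (hD : IsWeakJacobian Ω (f ∘ m) D)
    {G : Euc (d + 1) → (Euc (d + 1) →L[ℝ] Euc (d + 1))}
    (hG : ∀ᵐ ζ ∂(volume.restrict Ω), G (m ζ) = D ζ ∘L pinv (fderiv ℝ m ζ)) :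
    ∀ᵐ ζ ∂(volume.restrict Ω), D ζ = (Q (m ζ) ∘L G (m ζ)) ∘L fderiv ℝ m ζ
      - (fderiv ℝ (P ∘ m) ζ).flip (f (m ζ)) := by
  have hPf : ∀ᵐ ζ ∂(volume.restrict Ω), (P ∘ m) ζ ((f ∘ m) ζ) = 0 := by
    filter_upwards [ae_restrict_mem h.isOpen.measurableSet] with ζ hζ
    exact hPS _ (h.mem hζ) _ (hf _ (h.mem hζ))
  filter_upwards [hG, hD.apply_eq_neg_fderiv_apply h.isOpen hP hPf,
    ae_restrict_mem h.isOpen.measurableSet] with ζ h1 h2 hζ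
  -- The pseudoinverse is a left inverse of `∂m`, so no information on `D` is lost in `G`.
  have h3 : G (m ζ) ∘L fderiv ℝ m ζ = D ζ := by
    rw [h1, ContinuousLinearMap.comp_assoc, pinv_comp_self (h.injective_fderiv ζ hζ),
      ContinuousLinearMap.comp_id]
  rw [ContinuousLinearMap.comp_assoc, h3]
  ext1 v
  have h4 : Q (m ζ) (D ζ v) + P (m ζ) (D ζ v) = D ζ v := by
    rw [← add_apply, hQ, one_apply_eq_self]
  have h5 : P (m ζ) (D ζ v) = _ := h2 v
  rw [h5] at h4
  rw [sub_apply, sub_eq_add_neg]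
  exact h4.symm

/-- The formula for the Jacobian is linear in `(U, f)`, with coefficients `∂m` and `∂(P ∘ m)`
continuous on `Ω`. Thus every integral in the weak identity converges, and limits are unique. -/
lemma isWeakJacobian_of_tendsto (h : IsPatch M Ω m) (hP : ContDiffOn ℝ 1 (P ∘ m) Ω)
    {f : ℕ → Euc (d + 1) → Euc (d + 1)} {f₀ : Euc (d + 1) → Euc (d + 1)}
    {U : ℕ → Euc (d + 1) → (Euc (d + 1) →L[ℝ] Euc (d + 1))}
    {V : Euc (d + 1) → (Euc (d + 1) →L[ℝ] Euc (d + 1))}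
    (hf : ∀ k, MemLp (f k) 2 (surfaceMeasure M)) (hf₀ : MemLp f₀ 2 (surfaceMeasure M))
    (hU : ∀ k, MemLp (U k) 2 (surfaceMeasure M)) (hV : MemLp V 2 (surfaceMeasure M))
    (hflim : Tendsto (fun k => eLpNorm (f k - f₀) 2 (surfaceMeasure M)) atTop (𝓝 0))
    (hUlim : Tendsto (fun k => eLpNorm (U k - V) 2 (surfaceMeasure M)) atTop (𝓝 0))
    (hD : ∀ k, IsWeakJacobian Ω (f k ∘ m) fun ζ =>
      U k (m ζ) ∘L fderiv ℝ m ζ - (fderiv ℝ (P ∘ m) ζ).flip (f k (m ζ))) :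
    IsWeakJacobian Ω (f₀ ∘ m) fun ζ =>
      V (m ζ) ∘L fderiv ℝ m ζ - (fderiv ℝ (P ∘ m) ζ).flip (f₀ (m ζ)) := by
  have hdP : ContinuousOn (fderiv ℝ (P ∘ m)) Ω :=
    hP.continuousOn_fderiv_of_isOpen h.isOpen le_rfl
  refine ⟨h.locallyIntegrableOn_comp hf₀, ?_, ?_⟩
  · refine LocallyIntegrableOn.sub (f := fun ζ => V (m ζ) ∘L fderiv ℝ m ζ)
      (g := fun ζ => (fderiv ℝ (P ∘ m) ζ).flip (f₀ (m ζ))) ?_ ?_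
    · exact LocallyIntegrableOn.clm_apply_of_continuousOn h.isOpen
        (ψ := fun ζ => (ContinuousLinearMap.compL ℝ (Euc d) (Euc (d + 1)) (Euc (d + 1))).flip
          (fderiv ℝ m ζ))
        ((ContinuousLinearMap.continuous _).comp_continuousOn h.continuousOn_fderiv)
        (h.locallyIntegrableOn_comp hV)
    · exact LocallyIntegrableOn.clm_apply_of_continuousOn h.isOpen
        (ψ := fun ζ => (fderiv ℝ (P ∘ m) ζ).flip)
        ((ContinuousLinearMap.flipₗᵢ ℝ _ _ _).continuous.comp_continuousOn hdP)
        (h.locallyIntegrableOn_comp hf₀)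
  · intro φ hφ hc hs v
    have hsub : tsupport (fun ζ => fderiv ℝ φ ζ v) ⊆ tsupport φ :=
      (tsupport_comp_subset (g := fun L : Euc d →L[ℝ] ℝ => L v) rfl _).trans
        (tsupport_fderiv_subset ℝ)
    have t1 := h.tendsto_integral_smul_clm (φ := fun ζ => fderiv ℝ φ ζ v)
      ((hφ.continuous_fderiv one_ne_zero).clm_apply continuous_const)
      (hc.of_isClosed_subset (isClosed_tsupport _) hsub) (hsub.trans hs)
      (ψ := fun _ => ContinuousLinearMap.id ℝ (Euc (d + 1))) continuousOn_const hf hf₀ hflim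
    have c2 : ContinuousOn (fun ζ => ContinuousLinearMap.apply ℝ (Euc (d + 1))
        (fderiv ℝ m ζ v)) Ω :=
      (ContinuousLinearMap.continuous _).comp_continuousOn
        (h.continuousOn_fderiv.clm_apply continuousOn_const)
    have c3 : ContinuousOn (fun ζ => fderiv ℝ (P ∘ m) ζ v) Ω :=
      hdP.clm_apply continuousOn_const
    have t2 := h.tendsto_integral_smul_clm hφ.continuous hc hs c2 hU hV hUlim
    have t3 := h.tendsto_integral_smul_clm hφ.continuous hc hs c3 hf hf₀ hflim
    have split : ∀ {e : Euc (d + 1) → Euc (d + 1)}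
        {W : Euc (d + 1) → (Euc (d + 1) →L[ℝ] Euc (d + 1))},
        MemLp e 2 (surfaceMeasure M) → MemLp W 2 (surfaceMeasure M) →
        ∫ ζ in Ω, φ ζ • (W (m ζ) ∘L fderiv ℝ m ζ - (fderiv ℝ (P ∘ m) ζ).flip (e (m ζ))) v
          = (∫ ζ in Ω, φ ζ • ContinuousLinearMap.apply ℝ (Euc (d + 1)) (fderiv ℝ m ζ v)
              (W (m ζ))) - ∫ ζ in Ω, φ ζ • (fderiv ℝ (P ∘ m) ζ v) (e (m ζ)) := by
      intro e W he hW
      have i2 := integrable_testFunction_smul (LocallyIntegrableOn.clm_apply_of_continuousOn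
        h.isOpen c2 (h.locallyIntegrableOn_comp hW)) hφ.continuous hc hs
      have i3 := integrable_testFunction_smul (LocallyIntegrableOn.clm_apply_of_continuousOn
        h.isOpen c3 (h.locallyIntegrableOn_comp he)) hφ.continuous hc hs
      rw [← integral_sub i2 i3]
      simp [smul_sub]
    have heq : ∀ k, ∫ ζ in Ω, fderiv ℝ φ ζ v • ContinuousLinearMap.id ℝ (Euc (d + 1)) (f k (m ζ))
        = - ((∫ ζ in Ω, φ ζ • ContinuousLinearMap.apply ℝ (Euc (d + 1)) (fderiv ℝ m ζ v)
              (U k (m ζ))) - ∫ ζ in Ω, φ ζ • (fderiv ℝ (P ∘ m) ζ v) (f k (m ζ))) := by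
      intro k
      rw [← split (hf k) (hU k)]
      exact (hD k).integral_eq φ hφ hc hs v
    rw [split hf₀ hV]
    exact tendsto_nhds_unique t1 (((t2.sub t3).neg).congr fun k => (heq k).symm)

/-- `V` only prescribes the `Q` part of the limit gradient. Convergence a.e. supplies the rest: `U
k` and `u k` determine `G k` in each patch, so `G k` converges a.e. as well. -/
lemma IsCompressedGradient.exists_of_tendsto_ae (hM : IsHypersurface M)
    (hQ : ∀ x, Q x + P x = 1) (hPS : ∀ x ∈ M, ∀ y ∈ S x, P x y = 0)
    (hP : ∀ (Ω : Set (Euc d)) (m : Euc d → Euc (d + 1)), IsPatch M Ω m →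
      ContDiffOn ℝ 1 (P ∘ m) Ω)
    {u : ℕ → L2Fields M} {u₀ : L2Fields M}
    {U : ℕ → Euc (d + 1) → (Euc (d + 1) →L[ℝ] Euc (d + 1))}
    {V : Euc (d + 1) → (Euc (d + 1) →L[ℝ] Euc (d + 1))}
    (hu : ∀ k, IsCompressedGradient M S Q (u k) (U k))
    (hU : ∀ k, MemLp (U k) 2 (surfaceMeasure M)) (hV : MemLp V 2 (surfaceMeasure M))
    (hulim : Tendsto u atTop (𝓝 u₀))
    (hUlim : Tendsto (fun k => eLpNorm (U k - V) 2 (surfaceMeasure M)) atTop (𝓝 0))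
    (huae : ∀ᵐ x ∂(surfaceMeasure M), Tendsto (fun k => u k x) atTop (𝓝 (u₀ x)))
    (hUae : ∀ᵐ x ∂(surfaceMeasure M), Tendsto (fun k => U k x) atTop (𝓝 (V x))) :
    ∃ W, IsCompressedGradient M S Q u₀ W ∧ W =ᵐ[surfaceMeasure M] V := by
  classical
  choose f G h1 h2 h3 h4 using hu
  -- Values in `S x` are demanded at every point of `M`, but the limit has them only a.e.; the
  -- default `0` repairs the null set.
  let f₀ : Euc (d + 1) → Euc (d + 1) := fun x => if u₀ x ∈ S x then u₀ x else 0
  have huf : ∀ᵐ x ∂(surfaceMeasure M), ∀ k, u k x = f k x := ae_all_iff.2 h1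
  have hf₀ : u₀ =ᵐ[surfaceMeasure M] f₀ := by
    filter_upwards [huf, huae, ae_mem_of_isHypersurface hM] with x k1 k2 k3
    have : u₀ x ∈ S x :=
      (S x).closed_of_finiteDimensional.mem_of_tendsto k2
        (Eventually.of_forall fun k => by rw [k1 k]; exact h2 k x k3)
    simp only [f₀, if_pos this]
  have hfmem : ∀ k, MemLp (f k) 2 (surfaceMeasure M) := fun k => (Lp.memLp (u k)).ae_eq (h1 k)
  have hf₀mem : MemLp f₀ 2 (surfaceMeasure M) := (Lp.memLp u₀).ae_eq hf₀
  have hflim : Tendsto (fun k => eLpNorm (f k - f₀) 2 (surfaceMeasure M)) atTop (𝓝 0) := by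
    refine ((Lp.tendsto_Lp_iff_tendsto_eLpNorm' u u₀).1 hulim).congr fun k => ?_
    exact eLpNorm_congr_ae ((h1 k).sub hf₀)
  -- A pointwise limit on the ambient space makes no reference to a patch, so nothing has to be
  -- glued.
  let G₀ : Euc (d + 1) → (Euc (d + 1) →L[ℝ] Euc (d + 1)) := fun x =>
    limUnder atTop fun k => G k x
  have key : ∀ (Ω : Set (Euc d)) (m : Euc d → Euc (d + 1)), IsPatch M Ω m →
      ∃ D : Euc d → (Euc d →L[ℝ] Euc (d + 1)), IsWeakJacobian Ω (f₀ ∘ m) D ∧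
        ∀ᵐ ζ ∂(volume.restrict Ω), Tendsto (fun k => G k (m ζ)) atTop
          (𝓝 (D ζ ∘L pinv (fderiv ℝ m ζ))) := by
    intro Ω m hm
    choose D hD hDG using fun k => h3 k Ω m hm
    have hrep : ∀ k, D k =ᵐ[volume.restrict Ω] fun ζ =>
        U k (m ζ) ∘L fderiv ℝ m ζ - (fderiv ℝ (P ∘ m) ζ).flip (f k (m ζ)) := by
      intro k
      have := (hD k).eq_compressed_sub hm hQ hPS (hP Ω m hm) (h2 k) (hDG k)
      rw [h4 k]
      exact this
    refine ⟨_, isWeakJacobian_of_tendsto hm (hP Ω m hm) hfmem hf₀mem hU hV hflim hUlim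
      fun k => (hD k).congr (ae_eq_refl _) (hrep k), ?_⟩
    have hrep' : ∀ᵐ ζ ∂(volume.restrict Ω), ∀ k, D k ζ =
        U k (m ζ) ∘L fderiv ℝ m ζ - (fderiv ℝ (P ∘ m) ζ).flip (f k (m ζ)) := ae_all_iff.2 hrep
    have hDG' : ∀ᵐ ζ ∂(volume.restrict Ω), ∀ k, G k (m ζ) = D k ζ ∘L pinv (fderiv ℝ m ζ) :=
      ae_all_iff.2 hDG
    filter_upwards [hrep', hDG', hm.ae_comp huf, hm.ae_comp huae, hm.ae_comp hUae,
      hm.ae_comp hf₀] with ζ e1 e2 e3 e4 e5 e6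
    simp only [e2, e1]
    rw [← e6]
    simp only [← e3]
    refine ((continuous_id.clm_comp_const (pinv (fderiv ℝ m ζ))).tendsto _).comp (Tendsto.sub
      (((continuous_id.clm_comp_const (fderiv ℝ m ζ)).tendsto _).comp e5) ?_)
    exact ((ContinuousLinearMap.continuous _).tendsto _).comp e4
  have hgrad : IsSurfaceGradient M f₀ G₀ := by
    intro Ω m hm
    obtain ⟨D, hD, hlim⟩ := key Ω m hm
    refine ⟨D, hD, ?_⟩
    filter_upwards [hlim] with ζ hζ
    exact hζ.limUnder_eq
  have hGae : ∀ᵐ x ∂(surfaceMeasure M), Tendsto (fun k => G k x) atTop (𝓝 (G₀ x)) := by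
    refine ae_surfaceMeasure_of_forall_isPatch hM fun Ω m hm => ?_
    obtain ⟨D, -, hlim⟩ := key Ω m hm
    filter_upwards [hlim] with ζ hζ
    exact tendsto_nhds_limUnder ⟨_, hζ⟩
  refine ⟨_, ⟨f₀, G₀, hf₀, fun x _ => ?_, hgrad, rfl⟩, ?_⟩
  · by_cases h : u₀ x ∈ S x
    · simpa only [f₀, if_pos h] using h
    · simp only [f₀, if_neg h, zero_mem]
  · filter_upwards [hGae, hUae] with x k1 k2
    refine tendsto_nhds_unique (((continuous_id.const_clm_comp (Q x)).tendsto _).comp k1)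
      (k2.congr fun k => ?_)
    rw [h4 k]
    rfl

/-- The operator `u ↦ Q ∇_M u` is closed. -/
lemma IsCompressedGradient.exists_of_tendsto (hM : IsHypersurface M)
    (hQ : ∀ x, Q x + P x = 1) (hPS : ∀ x ∈ M, ∀ y ∈ S x, P x y = 0)
    (hP : ∀ (Ω : Set (Euc d)) (m : Euc d → Euc (d + 1)), IsPatch M Ω m →
      ContDiffOn ℝ 1 (P ∘ m) Ω)
    {u : ℕ → L2Fields M} {u₀ : L2Fields M}
    {U : ℕ → Euc (d + 1) → (Euc (d + 1) →L[ℝ] Euc (d + 1))}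
    {V : Euc (d + 1) → (Euc (d + 1) →L[ℝ] Euc (d + 1))}
    (hu : ∀ k, IsCompressedGradient M S Q (u k) (U k))
    (hU : ∀ k, MemLp (U k) 2 (surfaceMeasure M)) (hV : MemLp V 2 (surfaceMeasure M))
    (hulim : Tendsto u atTop (𝓝 u₀))
    (hUlim : Tendsto (fun k => eLpNorm (U k - V) 2 (surfaceMeasure M)) atTop (𝓝 0)) :
    ∃ W, IsCompressedGradient M S Q u₀ W ∧ W =ᵐ[surfaceMeasure M] V := by
  -- The second subsequence is taken inside the first, so that both a.e. limits hold along it.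
  obtain ⟨a, ha, hae⟩ := (tendstoInMeasure_of_tendsto_Lp hulim).exists_seq_tendsto_ae
  obtain ⟨b, hb, hbe⟩ := (tendstoInMeasure_of_tendsto_eLpNorm (f := fun k => U (a k))
    two_ne_zero (fun k => (hU (a k)).1) hV.1
    (hUlim.comp ha.tendsto_atTop)).exists_seq_tendsto_ae
  refine IsCompressedGradient.exists_of_tendsto_ae hM hQ hPS hP
    (u := fun k => u (a (b k))) (U := fun k => U (a (b k))) (fun k => hu _) (fun k => hU _) hV
    (hulim.comp (ha.comp hb).tendsto_atTop) (hUlim.comp (ha.comp hb).tendsto_atTop) ?_ hbe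
  filter_upwards [hae] with x hx
  exact hx.comp hb.tendsto_atTop

end Closed

/-! ### The tangential and the normal projection -/

section Projections

variable {d : ℕ} {M : Set (Euc (d + 1))} {n : Euc (d + 1) → Euc (d + 1)}

lemma projN_apply (n : Euc (d + 1) → Euc (d + 1)) (x y : Euc (d + 1)) :
    projN n x y = ⟪n x, y⟫_ℝ • n x := rfl

lemma projT_apply (n : Euc (d + 1) → Euc (d + 1)) (x y : Euc (d + 1)) :
    projT n x y = y - ⟪n x, y⟫_ℝ • n x := rfl

lemma projT_add_projN (n : Euc (d + 1) → Euc (d + 1)) (x : Euc (d + 1)) :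
    projT n x + projN n x = 1 := sub_add_cancel _ _

lemma IsUnitNormal.projN_eq_zero (hn : IsUnitNormal M n) {x y : Euc (d + 1)} (hx : x ∈ M)
    (hy : y ∈ tangentSpaceAt M x) : projN n x y = 0 := by
  rw [projN_apply, Submodule.inner_left_of_mem_orthogonal hy (hn.mem_normalSpace x hx), zero_smul]

/-- A single patch gives this lower bound. The upper bound comes from the unit normal, so tangent
spaces of different patches need not be compared. -/
lemma le_finrank_tangentSpaceAt (hM : IsHypersurface M) {x : Euc (d + 1)} (hx : x ∈ M) :
    d ≤ Module.finrank ℝ (tangentSpaceAt M x) := by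
  obtain ⟨Ω, m, hm, ζ, hζ, rfl⟩ := hM x hx
  have hle : LinearMap.range (fderiv ℝ m ζ : Euc d →ₗ[ℝ] Euc (d + 1))
      ≤ tangentSpaceAt M (m ζ) := by
    rintro _ ⟨h, rfl⟩
    exact Submodule.subset_span ⟨Ω, m, ζ, h, hm, hζ, rfl, rfl⟩
  calc d = Module.finrank ℝ (LinearMap.range (fderiv ℝ m ζ : Euc d →ₗ[ℝ] Euc (d + 1))) := by
        rw [LinearMap.finrank_range_of_inj (hm.injective_fderiv ζ hζ), finrank_euclideanSpace_fin]
    _ ≤ _ := Submodule.finrank_mono hle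

/-- The normal space has dimension at most `(d + 1) - d = 1` and contains `n x ≠ 0`. It is therefore
the line through `n x`, which `P_τ` kills. -/
lemma IsUnitNormal.projT_eq_zero (hM : IsHypersurface M) (hn : IsUnitNormal M n)
    {x y : Euc (d + 1)} (hx : x ∈ M) (hy : y ∈ normalSpaceAt M x) : projT n x y = 0 := by
  have hsum := (tangentSpaceAt M x).finrank_add_finrank_orthogonal
  rw [finrank_euclideanSpace_fin] at hsum
  have h1 := le_finrank_tangentSpaceAt hM hx
  have hne : (⟨n x, hn.mem_normalSpace x hx⟩ : normalSpaceAt M x) ≠ 0 := by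
    intro h
    have h0 : n x = 0 := congrArg Subtype.val h
    have := hn.norm_eq_one x hx
    rw [h0, norm_zero] at this
    exact zero_ne_one this
  have hle : Module.finrank ℝ (normalSpaceAt M x) ≤ 1 := by
    rw [normalSpaceAt]
    omega
  have : Nontrivial (normalSpaceAt M x) := ⟨_, _, hne⟩
  have h2 : Module.finrank ℝ (normalSpaceAt M x) = 1 :=
    le_antisymm hle Module.finrank_pos
  obtain ⟨c, hc⟩ := exists_smul_eq_of_finrank_eq_one h2 hne ⟨y, hy⟩
  have hy' : y = c • n x := (congrArg Subtype.val hc).symm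
  rw [projT_apply, hy', inner_smul_right, real_inner_self_eq_norm_sq, hn.norm_eq_one x hx]
  simp

lemma IsUnitNormal.contDiffOn_projN (hn : IsUnitNormal M n) {Ω : Set (Euc d)}
    {m : Euc d → Euc (d + 1)} (hm : IsPatch M Ω m) : ContDiffOn ℝ 1 (projN n ∘ m) Ω :=
  (((innerSL ℝ).contDiff.comp_contDiffOn (hn.contDiffOn Ω m hm)).smulRight
    (hn.contDiffOn Ω m hm))

lemma IsUnitNormal.contDiffOn_projT (hn : IsUnitNormal M n) {Ω : Set (Euc d)}
    {m : Euc d → Euc (d + 1)} (hm : IsPatch M Ω m) : ContDiffOn ℝ 1 (projT n ∘ m) Ω :=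
  contDiffOn_const.sub (hn.contDiffOn_projN hm)

lemma IsUnitNormal.inner_projT_projN (hn : IsUnitNormal M n) {x : Euc (d + 1)} (hx : x ∈ M)
    (y z : Euc (d + 1)) : ⟪projT n x y, projN n x z⟫_ℝ = 0 := by
  rw [projN_apply, projT_apply, inner_smul_right, inner_sub_left, inner_smul_left,
    real_inner_self_eq_norm_sq, hn.norm_eq_one x hx, real_inner_comm (n x) y]
  simp

lemma IsUnitNormal.frobInner_projT_projN (hn : IsUnitNormal M n) {x : Euc (d + 1)} (hx : x ∈ M)
    (A B : Euc (d + 1) →L[ℝ] Euc (d + 1)) : frobInner (projT n x ∘L A) (projN n x ∘L B) = 0 :=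
  Finset.sum_eq_zero fun _ _ => hn.inner_projT_projN hx _ _

lemma isTangentialGradient_iff {u : L2Fields M}
    {U : Euc (d + 1) → (Euc (d + 1) →L[ℝ] Euc (d + 1))} :
    IsTangentialGradient M n u U ↔
      IsCompressedGradient M (tangentSpaceAt M) (projT n) u U := Iff.rfl

lemma isNormalGradient_iff {u : L2Fields M}
    {U : Euc (d + 1) → (Euc (d + 1) →L[ℝ] Euc (d + 1))} :
    IsNormalGradient M n u U ↔
      IsCompressedGradient M (normalSpaceAt M) (projN n) u U := Iff.rfl

lemma IsProjectedGradient.ae_eq (hM : IsHypersurface M) {u : L2Fields M}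
    {U V : Euc (d + 1) → (Euc (d + 1) →L[ℝ] Euc (d + 1))} (hU : IsProjectedGradient M n u U)
    (hV : IsProjectedGradient M n u V) : U =ᵐ[surfaceMeasure M] V := by
  obtain ⟨f, G, H, h1, h2, h3, rfl⟩ := hU
  obtain ⟨g, G', H', k1, k2, k3, rfl⟩ := hV
  have hfg := h1.symm.trans k1
  have e1 := h2.ae_eq hM k2 (by filter_upwards [hfg] with x hx; rw [hx])
  have e2 := h3.ae_eq hM k3 (by filter_upwards [hfg] with x hx; rw [hx])
  filter_upwards [e1, e2] with x hx1 hx2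
  rw [hx1, hx2]

/-- The projected gradient of `v + w` with tangential `v` and normal `w`. -/
lemma IsTangentialGradient.add_isNormalGradient (hM : IsHypersurface M) (hn : IsUnitNormal M n)
    {v w : L2Fields M} {V W : Euc (d + 1) → (Euc (d + 1) →L[ℝ] Euc (d + 1))}
    (hV : IsTangentialGradient M n v V) (hW : IsNormalGradient M n w W) :
    IsProjectedGradient M n (v + w) (fun x => V x + W x) := by
  obtain ⟨f, G, h1, h2, h3, rfl⟩ := hV
  obtain ⟨g, H, k1, k2, k3, rfl⟩ := hW
  have hTf : ∀ x ∈ M, projT n x (f x) = f x := fun x hx => by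
    have := congrArg (fun L => L (f x)) (projT_add_projN n x)
    simpa [hn.projN_eq_zero hx (h2 x hx)] using this
  have hNg : ∀ x ∈ M, projN n x (g x) = g x := fun x hx => by
    have := congrArg (fun L => L (g x)) (projT_add_projN n x)
    simpa [hn.projT_eq_zero hM hx (k2 x hx)] using this
  refine ⟨fun x => f x + g x, G, H, (Lp.coeFn_add v w).trans (h1.add k1),
    h3.congr_of_eqOn fun x hx => ?_, k3.congr_of_eqOn fun x hx => ?_, rfl⟩
  · simp only [map_add, hTf x hx, hn.projT_eq_zero hM hx (k2 x hx), add_zero]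
  · simp only [map_add, hNg x hx, hn.projN_eq_zero hx (h2 x hx), zero_add]

lemma IsTangentialGradient.inner_isNormalGradient (hM : IsHypersurface M) (hn : IsUnitNormal M n)
    {v w : L2Fields M} {V W : Euc (d + 1) → (Euc (d + 1) →L[ℝ] Euc (d + 1))}
    (hV : IsTangentialGradient M n v V) (hW : IsNormalGradient M n w W) :
    ∀ᵐ x ∂(surfaceMeasure M), ⟪v x, w x⟫_ℝ = 0 ∧ frobInner (V x) (W x) = 0 := by
  obtain ⟨f, G, h1, h2, h3, rfl⟩ := hV
  obtain ⟨g, H, k1, k2, k3, rfl⟩ := hW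
  filter_upwards [h1, k1, ae_mem_of_isHypersurface hM] with x hx1 hx2 hx
  refine ⟨?_, hn.frobInner_projT_projN hx _ _⟩
  rw [hx1, hx2]
  exact Submodule.inner_right_of_mem_orthogonal (h2 x hx) (k2 x hx)

end Projections

/-! ### Hilbert spaces from closed graphs -/

/-- For the pulled back inner product `T` is an isometry, so completeness of `W` is completeness of
the range. -/
lemma IsHilbertSpaceWith.of_linearMap {W X : Type} [AddCommGroup W] [Module ℝ W]
    [NormedAddCommGroup X] [InnerProductSpace ℝ X] [CompleteSpace X] {B : W → W → ℝ}
    (T : W →ₗ[ℝ] X) (hB : ∀ u v, ⟪T u, T v⟫_ℝ = B u v) (hinj : Function.Injective T)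
    (hcl : IsClosed (Set.range T)) : IsHilbertSpaceWith W B := by
  let c : InnerProductSpace.Core ℝ W :=
    { inner := fun u v => ⟪T u, T v⟫_ℝ
      conj_inner_symm := fun u v => inner_conj_symm (T u) (T v)
      re_inner_nonneg := fun u => inner_self_nonneg (𝕜 := ℝ) (x := T u)
      add_left := fun u v w => by
        change ⟪T (u + v), T w⟫_ℝ = ⟪T u, T w⟫_ℝ + ⟪T v, T w⟫_ℝ
        rw [map_add, inner_add_left]
      smul_left := fun u v r => by
        change ⟪T (r • u), T v⟫_ℝ = _ * ⟪T u, T v⟫_ℝ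
        rw [map_smul, inner_smul_left]
      definite := fun u hu => hinj (by
        rw [map_zero]
        exact inner_self_eq_zero.1 hu) }
  refine ⟨c, hB, ?_⟩
  let := c.toNormedAddCommGroup
  have hnorm : ∀ u : W, ‖T u‖ = ‖u‖ := fun u => norm_eq_sqrt_re_inner (𝕜 := ℝ) (T u)
  have hT : Isometry T := AddMonoidHomClass.isometry_of_norm T hnorm
  exact (completeSpace_iff_isComplete_range hT.isUniformInducing).2 hcl.isComplete

/-- By orthogonality, `x ∈ A ⊔ B` exactly if `x` minus its projection to `A` lies in `B`: a closed
condition on `x`. -/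
lemma Submodule.isClosed_sup_of_isOrtho {X : Type*} [NormedAddCommGroup X]
    [InnerProductSpace ℝ X] [CompleteSpace X] {A B : Submodule ℝ X} (hAB : A ⟂ B)
    (hA : IsClosed (A : Set X)) (hB : IsClosed (B : Set X)) :
    IsClosed ((A ⊔ B : Submodule ℝ X) : Set X) := by
  have : CompleteSpace A := hA.completeSpace_coe
  have h : ((A ⊔ B : Submodule ℝ X) : Set X)
      = (fun x => x - A.starProjection x) ⁻¹' (B : Set X) := by
    ext x
    simp only [SetLike.mem_coe, Set.mem_preimage]
    constructor
    · intro hx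
      obtain ⟨a, ha, b, hb, rfl⟩ := Submodule.mem_sup.1 hx
      have h1 : A.starProjection a = a := Submodule.starProjection_eq_self_iff.2 ha
      have h2 : A.starProjection b = 0 :=
        (A.starProjection_apply_eq_zero_iff).2 (hAB.symm hb)
      rw [map_add, h1, h2]
      simpa using hb
    · intro hx
      exact Submodule.mem_sup.2 ⟨_, A.starProjection_apply_mem x, _, hx, by abel⟩
  rw [h]
  exact hB.preimage (continuous_id.sub A.starProjection.continuous)

/-- The matrices with the Frobenius inner product, as tuples of columns. -/
abbrev Columns (k : ℕ) : Type := PiLp 2 fun _ : Fin k => Euc k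

/-- The columns of a matrix. -/
def toColumns (k : ℕ) : (Euc k →L[ℝ] Euc k) →L[ℝ] Columns k :=
  (PiLp.continuousLinearEquiv 2 ℝ fun _ : Fin k => Euc k).symm.toContinuousLinearMap ∘L
    ContinuousLinearMap.pi fun j =>
      ContinuousLinearMap.apply ℝ (Euc k) (EuclideanSpace.single j (1 : ℝ))

/-- The matrix with given columns. -/
def ofColumns (k : ℕ) : Columns k →L[ℝ] (Euc k →L[ℝ] Euc k) :=
  ∑ j, ContinuousLinearMap.smulRightL ℝ (Euc k) (Euc k) (EuclideanSpace.proj j : Euc k →L[ℝ] ℝ) ∘L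
    PiLp.proj 2 (fun _ : Fin k => Euc k) j

lemma toColumns_apply {k : ℕ} (A : Euc k →L[ℝ] Euc k) (j : Fin k) :
    toColumns k A j = A (EuclideanSpace.single j 1) := rfl

lemma ofColumns_apply {k : ℕ} (B : Columns k) (x : Euc k) :
    ofColumns k B x = ∑ j, x j • B j := by
  simp [ofColumns]

lemma toColumns_ofColumns {k : ℕ} (B : Columns k) : toColumns k (ofColumns k B) = B := by
  refine PiLp.ext fun j => ?_
  rw [toColumns_apply, ofColumns_apply, Finset.sum_eq_single j]
  · simp
  · intro i _ hij
    simp [hij]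
  · simp

lemma ofColumns_toColumns {k : ℕ} (A : Euc k →L[ℝ] Euc k) : ofColumns k (toColumns k A) = A := by
  ext1 x
  rw [ofColumns_apply]
  simp only [toColumns_apply, ← map_smul, ← map_sum]
  congr 1
  conv_rhs => rw [← (EuclideanSpace.basisFun (Fin k) ℝ).sum_repr x]
  simp

/-- The operator norm on matrices is in general not Hilbertian; through `toColumns` the Frobenius
product becomes the inner product of a Hilbert space, as `L2Pairs` requires. -/
lemma inner_toColumns {k : ℕ} (A B : Euc k →L[ℝ] Euc k) :
    ⟪toColumns k A, toColumns k B⟫_ℝ = frobInner A B := by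
  rw [PiLp.inner_apply]
  rfl

/-! ### Graphs of gradient operators in `L² × L²` -/

section Graph

variable {d : ℕ} {M : Set (Euc (d + 1))}

/-- Pairs of a square integrable vector field and a square integrable matrix field. -/
abbrev L2Pairs (M : Set (Euc (d + 1))) : Type :=
  WithLp 2 (L2Fields M × Lp (Columns (d + 1)) 2 (surfaceMeasure M))

/-- `R` is (the graph of) a linear operator that maps classes of fields to classes of matrix
fields. -/
structure IsLinearRelation
    (R : L2Fields M → (Euc (d + 1) → (Euc (d + 1) →L[ℝ] Euc (d + 1))) → Prop) : Prop where
  add : ∀ {u v : L2Fields M} {U V : Euc (d + 1) → (Euc (d + 1) →L[ℝ] Euc (d + 1))},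
    R u U → R v V → R (u + v) (fun x => U x + V x)
  const_smul : ∀ {u : L2Fields M} {U : Euc (d + 1) → (Euc (d + 1) →L[ℝ] Euc (d + 1))},
    R u U → ∀ c : ℝ, R (c • u) (fun x => c • U x)
  ae_eq : ∀ {u : L2Fields M} {U V : Euc (d + 1) → (Euc (d + 1) →L[ℝ] Euc (d + 1))},
    R u U → R u V → U =ᵐ[surfaceMeasure M] V

variable {R : L2Fields M → (Euc (d + 1) → (Euc (d + 1) →L[ℝ] Euc (d + 1))) → Prop}
  {W : Submodule ℝ (L2Fields M)}

/-- The chosen gradient may differ from the square integrable one, but only on a null set. -/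
lemma IsLinearRelation.epsilon_spec (hR : IsLinearRelation R)
    (hW : ∀ u ∈ W, ∃ U, R u U ∧ MemLp U 2 (surfaceMeasure M)) (u : W) :
    R u (Classical.epsilon (R u)) ∧
      MemLp (toColumns (d + 1) ∘ Classical.epsilon (R u)) 2 (surfaceMeasure M) := by
  obtain ⟨U, h1, h2⟩ := hW u u.2
  have h3 : R u (Classical.epsilon (R u)) := Classical.epsilon_spec ⟨U, h1⟩
  exact ⟨h3, (toColumns (d + 1)).comp_memLp' (h2.ae_eq (hR.ae_eq h1 h3))⟩

/-- The linear map `u ↦ (u, U)`. -/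
def IsLinearRelation.graphMap (hR : IsLinearRelation R)
    (hW : ∀ u ∈ W, ∃ U, R u U ∧ MemLp U 2 (surfaceMeasure M)) : W →ₗ[ℝ] L2Pairs M where
  toFun u := WithLp.toLp 2 ((u : L2Fields M), (hR.epsilon_spec hW u).2.toLp)
  map_add' u v := by
    have h : (hR.epsilon_spec hW (u + v)).2.toLp
        = (hR.epsilon_spec hW u).2.toLp + (hR.epsilon_spec hW v).2.toLp := by
      rw [← MemLp.toLp_add]
      refine MemLp.toLp_congr _ _ ?_
      filter_upwards [hR.ae_eq (hR.epsilon_spec hW (u + v)).1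
        (hR.add (hR.epsilon_spec hW u).1 (hR.epsilon_spec hW v).1)] with x hx
      simp only [Function.comp_apply, hx, Pi.add_apply, map_add]
    rw [h]
    rfl
  map_smul' c u := by
    have h : (hR.epsilon_spec hW (c • u)).2.toLp = c • (hR.epsilon_spec hW u).2.toLp := by
      rw [← MemLp.toLp_const_smul]
      refine MemLp.toLp_congr _ _ ?_
      filter_upwards [hR.ae_eq (hR.epsilon_spec hW (c • u)).1
        (hR.const_smul (hR.epsilon_spec hW u).1 c)] with x hx
      simp only [Function.comp_apply, hx, Pi.smul_apply, map_smul]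
    rw [h]
    rfl

lemma IsLinearRelation.graphMap_injective (hR : IsLinearRelation R)
    (hW : ∀ u ∈ W, ∃ U, R u U ∧ MemLp U 2 (surfaceMeasure M)) :
    Function.Injective (hR.graphMap hW) := fun _ _ huv =>
  Subtype.ext (congrArg (fun p : L2Pairs M => p.fst) huv)

lemma IsLinearRelation.inner_graphMap (hR : IsLinearRelation R)
    (hW : ∀ u ∈ W, ∃ U, R u U ∧ MemLp U 2 (surfaceMeasure M)) (u v : W) :
    ⟪hR.graphMap hW u, hR.graphMap hW v⟫_ℝ = sobolevInner M R u v := by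
  rw [WithLp.prod_inner_apply, sobolevInner]
  congr 1
  rw [L2.inner_def]
  refine integral_congr_ae ?_
  filter_upwards [(hR.epsilon_spec hW u).2.coeFn_toLp, (hR.epsilon_spec hW v).2.coeFn_toLp]
    with x hx hy
  change ⟪(hR.epsilon_spec hW u).2.toLp _ x, (hR.epsilon_spec hW v).2.toLp _ x⟫_ℝ = _
  rw [hx, hy]
  exact inner_toColumns _ _

/-- Removes the choice operator: by uniqueness a.e., any representative `U` describes the graph. -/
lemma IsLinearRelation.mem_range_graphMap (hR : IsLinearRelation R)
    (hW : ∀ u ∈ W, ∃ U, R u U ∧ MemLp U 2 (surfaceMeasure M)) {p : L2Pairs M} :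
    p ∈ LinearMap.range (hR.graphMap hW) ↔ p.fst ∈ W ∧ ∃ U, R p.fst U ∧
      MemLp U 2 (surfaceMeasure M) ∧ p.snd =ᵐ[surfaceMeasure M] toColumns (d + 1) ∘ U := by
  constructor
  · rintro ⟨u, rfl⟩
    obtain ⟨U, h1, h2⟩ := hW u u.2
    refine ⟨u.2, U, h1, h2, (hR.epsilon_spec hW u).2.coeFn_toLp.trans ?_⟩
    filter_upwards [hR.ae_eq (hR.epsilon_spec hW u).1 h1] with x hx
    simp only [Function.comp_apply, hx]
  · rintro ⟨h1, U, h2, -, h4⟩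
    refine ⟨⟨p.fst, h1⟩, ?_⟩
    have : (hR.epsilon_spec hW ⟨p.fst, h1⟩).2.toLp = p.snd := by
      refine Lp.ext ((hR.epsilon_spec hW ⟨p.fst, h1⟩).2.coeFn_toLp.trans (EventuallyEq.trans ?_
        h4.symm))
      filter_upwards [hR.ae_eq (hR.epsilon_spec hW ⟨p.fst, h1⟩).1 h2] with x hx
      simp only [Function.comp_apply, hx]
    change WithLp.toLp 2 (p.fst, (hR.epsilon_spec hW ⟨p.fst, h1⟩).2.toLp) = p
    rw [this]
    rfl

lemma IsLinearRelation.isHilbertSpaceWith (hR : IsLinearRelation R)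
    (hW : ∀ u ∈ W, ∃ U, R u U ∧ MemLp U 2 (surfaceMeasure M))
    (hcl : IsClosed (LinearMap.range (hR.graphMap hW) : Set (L2Pairs M))) :
    IsHilbertSpaceWith W (fun u v => sobolevInner M R u v) :=
  IsHilbertSpaceWith.of_linearMap (hR.graphMap hW) (hR.inner_graphMap hW)
    (hR.graphMap_injective hW) (by
      rw [← LinearMap.coe_range]
      exact hcl)

lemma IsCompressedGradient.isClosed_range (hM : IsHypersurface M)
    {S : Euc (d + 1) → Submodule ℝ (Euc (d + 1))}
    {P Q : Euc (d + 1) → (Euc (d + 1) →L[ℝ] Euc (d + 1))}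
    (hQ : ∀ x, Q x + P x = 1) (hPS : ∀ x ∈ M, ∀ y ∈ S x, P x y = 0)
    (hP : ∀ (Ω : Set (Euc d)) (m : Euc d → Euc (d + 1)), IsPatch M Ω m →
      ContDiffOn ℝ 1 (P ∘ m) Ω)
    (hR : IsLinearRelation (IsCompressedGradient M S Q))
    (hW : ∀ u, u ∈ W ↔ ∃ U, IsCompressedGradient M S Q u U ∧ MemLp U 2 (surfaceMeasure M)) :
    IsClosed (LinearMap.range (hR.graphMap fun u => (hW u).1) : Set (L2Pairs M)) := by
  refine IsSeqClosed.isClosed fun p q hp hpq => ?_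
  simp only [SetLike.mem_coe, hR.mem_range_graphMap] at hp ⊢
  choose hp1 U hU hUmem hUeq using hp
  have hlim1 : Tendsto (fun k => (p k).fst) atTop (𝓝 q.fst) :=
    ((WithLp.prod_continuous_ofLp 2 _ _).fst.tendsto q).comp hpq
  have hlim2 : Tendsto (fun k => (p k).snd) atTop (𝓝 q.snd) :=
    ((WithLp.prod_continuous_ofLp 2 _ _).snd.tendsto q).comp hpq
  -- The limit is turned back into a matrix field; boundedness of `ofColumns` carries the
  -- convergence over.
  set V : Euc (d + 1) → (Euc (d + 1) →L[ℝ] Euc (d + 1)) := ofColumns (d + 1) ∘ q.snd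
  have hV : MemLp V 2 (surfaceMeasure M) := (ofColumns (d + 1)).comp_memLp' (Lp.memLp q.snd)
  have hUlim : Tendsto (fun k => eLpNorm (U k - V) 2 (surfaceMeasure M)) atTop (𝓝 0) := by
    have h0 := (Lp.tendsto_Lp_iff_tendsto_eLpNorm' _ _).1 hlim2
    have h1 : ∀ k, eLpNorm (U k - V) 2 (surfaceMeasure M)
        ≤ ENNReal.ofReal ‖ofColumns (d + 1)‖ *
          eLpNorm ((p k).snd - q.snd : Euc (d + 1) → Columns (d + 1)) 2 (surfaceMeasure M) := by
      intro k
      refine eLpNorm_le_mul_eLpNorm_of_ae_le_mul ?_ 2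
      filter_upwards [hUeq k] with x hx
      have h2 : U k x - V x = ofColumns (d + 1) ((p k).snd x - q.snd x) := by
        rw [map_sub, hx, Function.comp_apply, ofColumns_toColumns]
        rfl
      rw [Pi.sub_apply, Pi.sub_apply, h2]
      exact (ofColumns (d + 1)).le_opNorm _
    refine tendsto_of_tendsto_of_tendsto_of_le_of_le tendsto_const_nhds ?_ (fun _ => zero_le) h1
    simpa using ENNReal.Tendsto.const_mul (a := ENNReal.ofReal ‖ofColumns (d + 1)‖) h0
      (Or.inr ENNReal.ofReal_ne_top)
  obtain ⟨V', h1, h2⟩ := IsCompressedGradient.exists_of_tendsto hM hQ hPS hP hU hUmem hV hlim1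
    hUlim
  have h3 : MemLp V' 2 (surfaceMeasure M) := hV.ae_eq h2.symm
  refine ⟨(hW _).2 ⟨V', h1, h3⟩, V', h1, h3, ?_⟩
  filter_upwards [h2] with x hx
  rw [Function.comp_apply, hx]
  exact (toColumns_ofColumns _).symm

end Graph

/-! ### The three Sobolev spaces -/

section Main

variable {d : ℕ} {M : Set (Euc (d + 1))} {n : Euc (d + 1) → Euc (d + 1)}

lemma isLinearRelation_isTangentialGradient (hM : IsHypersurface M) :
    IsLinearRelation (IsTangentialGradient M n) where
  add := IsTangentialGradient.add
  const_smul := IsTangentialGradient.const_smul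
  ae_eq := fun h1 h2 =>
    IsCompressedGradient.ae_eq hM (isTangentialGradient_iff.1 h1) (isTangentialGradient_iff.1 h2)

lemma isLinearRelation_isNormalGradient (hM : IsHypersurface M) :
    IsLinearRelation (IsNormalGradient M n) where
  add := IsNormalGradient.add
  const_smul := IsNormalGradient.const_smul
  ae_eq := fun h1 h2 =>
    IsCompressedGradient.ae_eq hM (isNormalGradient_iff.1 h1) (isNormalGradient_iff.1 h2)

lemma isLinearRelation_isProjectedGradient (hM : IsHypersurface M) :
    IsLinearRelation (IsProjectedGradient M n) where
  add := IsProjectedGradient.add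
  const_smul := IsProjectedGradient.const_smul
  ae_eq := IsProjectedGradient.ae_eq hM

lemma mem_H1tau_iff {u : L2Fields M} :
    u ∈ H1tau M n ↔ ∃ U, IsTangentialGradient M n u U ∧ MemLp U 2 (surfaceMeasure M) := Iff.rfl

lemma mem_H1nor_iff {u : L2Fields M} :
    u ∈ H1nor M n ↔ ∃ U, IsNormalGradient M n u U ∧ MemLp U 2 (surfaceMeasure M) := Iff.rfl

lemma mem_H1amb_iff {u : L2Fields M} :
    u ∈ H1amb M n ↔ (∃ v ∈ H1tau M n, ∃ w ∈ H1nor M n, u = v + w) ∧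
      ∃ U, IsProjectedGradient M n u U ∧ MemLp U 2 (surfaceMeasure M) := Iff.rfl

/-- The graph of the tangential gradient. -/
def tangentialGraph (hM : IsHypersurface M) (n : Euc (d + 1) → Euc (d + 1)) :
    Submodule ℝ (L2Pairs M) :=
  LinearMap.range ((isLinearRelation_isTangentialGradient (n := n) hM).graphMap
    fun _ => mem_H1tau_iff.1)

/-- The graph of the normal gradient. -/
def normalGraph (hM : IsHypersurface M) (n : Euc (d + 1) → Euc (d + 1)) :
    Submodule ℝ (L2Pairs M) :=
  LinearMap.range ((isLinearRelation_isNormalGradient (n := n) hM).graphMap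
    fun _ => mem_H1nor_iff.1)

/-- The complementary projection `P_n` annihilates tangential fields and is `C¹` along patches
because `n` is. The normal case exchanges the two projections. -/
lemma isClosed_tangentialGraph (hM : IsHypersurface M) (hn : IsUnitNormal M n) :
    IsClosed (tangentialGraph hM n : Set (L2Pairs M)) :=
  IsCompressedGradient.isClosed_range hM (P := projN n) (projT_add_projN n)
    (fun _ hx _ hy => hn.projN_eq_zero hx hy) (fun _ _ hm => hn.contDiffOn_projN hm)
    (isLinearRelation_isTangentialGradient hM) (fun _ => mem_H1tau_iff)

lemma isClosed_normalGraph (hM : IsHypersurface M) (hn : IsUnitNormal M n) :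
    IsClosed (normalGraph hM n : Set (L2Pairs M)) :=
  IsCompressedGradient.isClosed_range hM (P := projT n)
    (fun x => (add_comm _ _).trans (projT_add_projN n x))
    (fun _ hx _ hy => hn.projT_eq_zero hM hx hy) (fun _ _ hm => hn.contDiffOn_projT hm)
    (isLinearRelation_isNormalGradient hM) (fun _ => mem_H1nor_iff)

lemma isOrtho_tangentialGraph_normalGraph (hM : IsHypersurface M) (hn : IsUnitNormal M n) :
    tangentialGraph hM n ⟂ normalGraph hM n := by
  rw [Submodule.isOrtho_iff_inner_eq]
  intro p hp q hq
  obtain ⟨-, U, hU, -, hpU⟩ := (IsLinearRelation.mem_range_graphMap _ _).1 hp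
  obtain ⟨-, V, hV, -, hqV⟩ := (IsLinearRelation.mem_range_graphMap _ _).1 hq
  have h := hU.inner_isNormalGradient hM hn hV
  rw [WithLp.prod_inner_apply, L2.inner_def, L2.inner_def]
  have h1 : ∀ᵐ x ∂(surfaceMeasure M), ⟪p.fst x, q.fst x⟫_ℝ = 0 := h.mono fun x hx => hx.1
  have h2 : ∀ᵐ x ∂(surfaceMeasure M), ⟪p.snd x, q.snd x⟫_ℝ = 0 := by
    filter_upwards [h, hpU, hqV] with x hx e1 e2
    rw [e1, e2, Function.comp_apply, Function.comp_apply, inner_toColumns, hx.2]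
  have i1 := integral_eq_zero_of_ae (f := fun x => ⟪p.fst x, q.fst x⟫_ℝ) h1
  have i2 := integral_eq_zero_of_ae (f := fun x => ⟪p.snd x, q.snd x⟫_ℝ) h2
  exact (congrArg₂ (· + ·) i1 i2).trans (add_zero 0)

/-- If `u = v + w` with tangential `v` and normal `w`, then `P_τ u = v` and `P_n u = w` a.e., so
uniqueness forces `U = V + W` a.e. Conversely, each graph embeds with the other summand zero, and
the range is a subspace. -/
lemma range_graphMap_isProjectedGradient (hM : IsHypersurface M) (hn : IsUnitNormal M n) :
    LinearMap.range ((isLinearRelation_isProjectedGradient (n := n) hM).graphMap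
      fun _ hu => (mem_H1amb_iff.1 hu).2) = tangentialGraph hM n ⊔ normalGraph hM n := by
  apply le_antisymm
  · rintro p hp
    obtain ⟨hp1, U, hU, -, hpU⟩ := (IsLinearRelation.mem_range_graphMap _ _).1 hp
    obtain ⟨⟨v, hv, w, hw, hvw⟩, -⟩ := mem_H1amb_iff.1 hp1
    let a := (isLinearRelation_isTangentialGradient (n := n) hM).graphMap
      (fun _ => mem_H1tau_iff.1) ⟨v, hv⟩
    let b := (isLinearRelation_isNormalGradient (n := n) hM).graphMap
      (fun _ => mem_H1nor_iff.1) ⟨w, hw⟩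
    have ha : a ∈ tangentialGraph hM n := LinearMap.mem_range_self _ _
    have hb : b ∈ normalGraph hM n := LinearMap.mem_range_self _ _
    obtain ⟨-, V, hV, -, haV⟩ := (IsLinearRelation.mem_range_graphMap _ _).1 ha
    obtain ⟨-, Z, hZ, -, hbZ⟩ := (IsLinearRelation.mem_range_graphMap _ _).1 hb
    have hsum : IsProjectedGradient M n p.fst (fun x => V x + Z x) := by
      rw [hvw]
      exact hV.add_isNormalGradient hM hn hZ
    have hsnd : p.snd = a.snd + b.snd := by
      refine Lp.ext (hpU.trans (EventuallyEq.trans ?_ (Lp.coeFn_add _ _).symm))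
      filter_upwards [hU.ae_eq hM hsum, haV, hbZ] with x e1 e2 e3
      rw [Function.comp_apply, e1, Pi.add_apply, e2, e3]
      exact map_add (toColumns (d + 1)) _ _
    refine Submodule.mem_sup.2 ⟨a, ha, b, hb, ?_⟩
    have hfst : p.fst = a.fst + b.fst := hvw
    exact (congrArg₂ (fun s t => (WithLp.toLp 2 (s, t) : L2Pairs M)) hfst hsnd).symm
  · refine sup_le_iff.2 ⟨fun p hp => ?_, fun p hp => ?_⟩
    · obtain ⟨hp1, U, hU, hUm, hpU⟩ := (IsLinearRelation.mem_range_graphMap _ _).1 hp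
      have h := hU.add_isNormalGradient hM hn (IsNormalGradient.zero M n)
      simp only [add_zero] at h
      exact (IsLinearRelation.mem_range_graphMap _ _).2
        ⟨mem_H1amb_iff.2 ⟨⟨_, hp1, 0, zero_mem _, (add_zero _).symm⟩, U, h, hUm⟩, U, h, hUm, hpU⟩
    · obtain ⟨hp1, U, hU, hUm, hpU⟩ := (IsLinearRelation.mem_range_graphMap _ _).1 hp
      have h := (IsTangentialGradient.zero M n).add_isNormalGradient hM hn hU
      simp only [zero_add] at h
      exact (IsLinearRelation.mem_range_graphMap _ _).2
        ⟨mem_H1amb_iff.2 ⟨⟨0, zero_mem _, _, hp1, (zero_add _).symm⟩, U, h, hUm⟩, U, h, hUm, hpU⟩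

end Main

end

/-- The curvature bound is not needed for completeness: the zero order terms only have to be bounded
in each local parametrization, which follows from `n` being of class `C¹`. -/
theorem mainTheorem2 (d : ℕ) (M : Set (Euc (d + 1))) (n : Euc (d + 1) → Euc (d + 1))
    (hM : IsHypersurface M) (hn : IsUnitNormal M n) (hC : ∃ C : ℝ, CurvatureBound M n C) :
    IsHilbertSpaceWith (H1amb M n)
        (fun u v => sobolevInner M (IsProjectedGradient M n) u v) ∧
      IsHilbertSpaceWith (H1tau M n)
        (fun u v => sobolevInner M (IsTangentialGradient M n) u v) ∧
      IsHilbertSpaceWith (H1nor M n)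
        (fun u v => sobolevInner M (IsNormalGradient M n) u v) := by
  refine ⟨IsLinearRelation.isHilbertSpaceWith (isLinearRelation_isProjectedGradient hM)
      (fun _ hu => (mem_H1amb_iff.1 hu).2) ?_,
    IsLinearRelation.isHilbertSpaceWith (isLinearRelation_isTangentialGradient hM)
      (fun _ => mem_H1tau_iff.1) (isClosed_tangentialGraph hM hn),
    IsLinearRelation.isHilbertSpaceWith (isLinearRelation_isNormalGradient hM)
      (fun _ => mem_H1nor_iff.1) (isClosed_normalGraph hM hn)⟩
  rw [range_graphMap_isProjectedGradient hM hn]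
  exact Submodule.isClosed_sup_of_isOrtho (isOrtho_tangentialGraph_normalGraph hM hn)
    (isClosed_tangentialGraph hM hn) (isClosed_normalGraph hM hn)
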